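/- Let $p > 11$ be a prime. Then the space $S_{p-1}(\Gamma(1))$ of cusp forms of weight $p-1$ and level $1$ (that is, for $\Gamma(1)=\mathrm{SL}_2(\mathbb{Z})$) contains a $p$-ordinary Hecke eigenform: there is a nonzero $f \in S_{p-1}(\Gamma(1))$ that is an eigenvector of every Hecke operator $T_n$, $n \ge 1$, and whose eigenvalue under $T_p$ is an algebraic integer prime to $p$. Here, in weight $k$, $(T_n f)(z) = n^{k-1} \sum_{ad = n,\ a,d\ge 1}\ \sum_{b=0}^{d-1} d^{-k} f\!\left(\frac{az+b}{d}\right)$, and an algebraic integer is said to be prime to $p$ if some coefficient other than the leading one of its characteristic polynomial (that is, of its minimal polynomial over $\mathbb{Q}$, which has integer coefficients) is nonzero modulo $p$. -/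

import Mathlib

open scoped MatrixGroups

/-- The `n`-th Hecke operator of weight `k` and level one (`n ≥ 1`), in its usual normalization
`(T_n f)(z) = n ^ (k - 1) * ∑_{a d = n, a, d ≥ 1} ∑_{0 ≤ b < d} d ^ (-k) * f ((a z + b) / d)`.
It is written on arbitrary functions on the upper half plane. Each point `(a z + b) / d` lies in the
upper half plane, and `UpperHalfPlane.ofComplex` merely regards it as an element of it. -/
noncomputable def heckeOperator (k : ℤ) (n : ℕ) (f : UpperHalfPlane → ℂ) : UpperHalfPlane → ℂ :=
  fun z ↦ (n : ℂ) ^ (k - 1) * ∑ x ∈ n.divisorsAntidiagonal, ∑ b ∈ Finset.range x.2,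
    (x.2 : ℂ) ^ (-k) * f (UpperHalfPlane.ofComplex (((x.1 : ℂ) * (z : ℂ) + (b : ℂ)) / (x.2 : ℂ)))

/-- A Hecke eigenform in the space of cusp forms of weight `k` and level one: a nonzero cusp form
that is an eigenvector of all the Hecke operators `T_n`, `n ≥ 1`. -/
def IsHeckeEigenform {k : ℤ} (f : CuspForm 𝒮ℒ k) : Prop :=
  f ≠ 0 ∧ ∀ n : ℕ, 1 ≤ n → ∃ c : ℂ, heckeOperator k n ⇑f = c • ⇑f

/-- `c` is an algebraic integer, and is prime to `p`: some coefficient, other than the leading one,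
of its characteristic polynomial is nonzero modulo `p`. The characteristic polynomial of an
algebraic integer `c` (that of multiplication by `c` on `ℚ(c)`) is its minimal polynomial, which
is monic with integer coefficients. -/
def IsAlgebraicIntegerPrimeTo (p : ℕ) (c : ℂ) : Prop :=
  IsIntegral ℤ c ∧ ∃ i < (minpoly ℤ c).natDegree, ¬ (p : ℤ) ∣ (minpoly ℤ c).coeff i

/-- A Hecke eigenform is ordinary at `p` if its `p`-th Hecke eigenvalue is an algebraic integer
prime to `p`. -/
def IsOrdinaryEigenform (p : ℕ) {k : ℤ} (f : CuspForm 𝒮ℒ k) : Prop :=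
  IsHeckeEigenform f ∧
    ∃ c : ℂ, heckeOperator k p ⇑f = c • ⇑f ∧ IsAlgebraicIntegerPrimeTo p c

/-!
# An ordinary eigenform of level one and weight `p - 1`

Every Hecke eigenform in the space `S` of cusp forms of level one and weight `p - 1` is ordinary
at `p`, because `T_p` is invertible modulo `p` on the lattice of cusp forms with integral
`q`-expansion. As `p > 11`, the space `S` is nonzero, and since the Hecke operators commute
(`Hecke.commute_onCuspForm`) it contains an eigenform.

**From the lattice to eigenvalues.** The space `S` has an echelon basis of forms with integral
`q`-expansion, dual to the first coefficients (`IntegralEisenstein.exists_cuspForm_isQExpansion`),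
and in it `T_p` has an integral matrix `M`. An eigenvalue `c` is a root of the characteristic
polynomial of `M`, so the constant term of the minimal polynomial of `c` divides `det M`
(`isAlgebraicIntegerPrimeTo_of_vecMul_eq_smul`). Modulo `p` the operator `T_p` sends `∑ a_n q ^ n`
to `∑ a_{pn} q ^ n`. Hence it has to be shown that an integral form of weight `p - 1` with
`a_{pn} ≡ 0` modulo `p` for all `n` is `0` modulo `p`.

**Forms modulo `p`.** The reduction modulo `p` of an integral form of weight `k` is `φ(Q, R)` for
an isobaric polynomial `φ` of weight `k`, where `Q` and `R` are the reductions of `E₄` and `E₆`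
(`IntegralEisenstein.IsQExpansion.exists_eval_eq`). By the theorem of von Staudt and Clausen there
is an isobaric polynomial `A` of weight `p - 1` with `A(Q, R) = 1`
(`IntegralEisenstein.exists_eval_eq_one`). The operator `θ = q d/dq` is expressed by
`12 θ φ = ∂ φ + k P φ`, where `P` is the reduction of `E₂` and `∂` is the derivation of `𝔽_p[Q, R]`
with `∂ Q = -4 R` and `∂ R = -6 Q ^ 2`; these are Ramanujan's differential equations. Thus `B = ∂ A` reduces
to `P` and `∂ B = -Q A`, which implies that `A` and `B` are relatively prime
(`RamanujanTriple.isRelPrime_serreDerivation`).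

**The theta cycle.** Let `φ` have weight `p - 1` and vanishing coefficients at the multiples of
`p`, so that `θ ^ (p - 1) φ = φ`. As the weight is `-1` modulo `p`, the form `144 θ ^ 2 φ` is the
reduction of `γ = ∂ ∂ φ + Q φ`, of weight `p + 3`. Applying `x ↦ A ∂ x + k B x`, which realizes
`12 θ` in weight `k`, another `p - 3` times gives a form with the same expansion as `φ`, that is,
`φ A ^ (p - 1)`. In each of these steps the weight is not `0` modulo `p`, so that `A` divides the
result only if it divides the argument. Hence `A` divides `γ`, and the quotient, of weight `4`, is
a multiple of `Q`. But the constant term of `θ ^ 2 φ` is `0`, so `θ ^ 2 φ = 0` and `φ = 0`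
(`RamanujanTriple.eval_eq_zero_of_coeff_mul_eq_zero`).

Hecke operators are treated as sums over `SL(2, ℤ)`-cosets of integral matrices of determinant
`n`; their commutation is verified on `q`-expansions.
-/

/-! ### Factors of weighted homogeneous polynomials -/

namespace MvPolynomial

variable {σ R : Type*} [CommRing R]

/-- The homomorphism `X i ↦ t ^ w i * X i` into polynomials in an extra variable `t`: it records the
weight of each monomial as an exponent of `t`. -/
noncomputable def weightTracker (w : σ → ℕ) :
    MvPolynomial σ R →ₐ[R] Polynomial (MvPolynomial σ R) :=
  aeval fun i ↦ Polynomial.monomial (w i) (X i)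

lemma weightTracker_monomial (w : σ → ℕ) (d : σ →₀ ℕ) (r : R) :
    weightTracker w (monomial d r) = Polynomial.monomial (Finsupp.weight w d) (monomial d r) := by
  induction d using Finsupp.induction_linear generalizing r with
  | zero => simp [weightTracker, Polynomial.algebraMap_apply, algebraMap_eq]
  | add d e hd he =>
    have h : (monomial (d + e) r : MvPolynomial σ R) = monomial d r * monomial e 1 := by
      rw [monomial_mul, mul_one]
    rw [h, map_mul, hd, he, Polynomial.monomial_mul_monomial, map_add]
  | single i n =>
    rw [← C_mul_X_pow_eq_monomial, map_mul, map_pow]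
    simp [weightTracker, Polynomial.monomial_pow, Polynomial.algebraMap_apply, algebraMap_eq,
      Polynomial.C_mul_monomial, Finsupp.weight_single, mul_comm]

lemma coeff_weightTracker (w : σ → ℕ) (φ : MvPolynomial σ R) (n : ℕ) :
    (weightTracker w φ).coeff n = weightedHomogeneousComponent w n φ := by
  induction φ using MvPolynomial.induction_on' with
  | monomial d r =>
    classical
    rw [weightTracker_monomial, Polynomial.coeff_monomial,
      weightedHomogeneousComponent_of_mem (n := Finsupp.weight w d)
        (isWeightedHomogeneous_monomial w d r rfl)]
    simp only [eq_comm]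
  | add p q hp hq => simp [hp, hq]

lemma isWeightedHomogeneous_iff_weightTracker {w : σ → ℕ} {φ : MvPolynomial σ R} {n : ℕ} :
    IsWeightedHomogeneous w φ n ↔ weightTracker w φ = Polynomial.monomial n φ := by
  classical
  constructor
  · intro h
    ext1 m
    rw [coeff_weightTracker, weightedHomogeneousComponent_of_mem h, Polynomial.coeff_monomial]
    simp only [eq_comm]
  · intro h
    have := coeff_weightTracker w φ n
    rw [h, Polynomial.coeff_monomial_same] at this
    rw [this]
    exact weightedHomogeneousComponent_isWeightedHomogeneous n φ

/-- In a polynomial ring over a domain, the factors of a nonzero weighted homogeneous polynomial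
are weighted homogeneous. -/
lemma IsWeightedHomogeneous.exists_of_mul_eq [IsDomain R] {w : σ → ℕ} {φ ψ χ : MvPolynomial σ R}
    {n : ℕ} (hχ : IsWeightedHomogeneous w χ n) (h0 : χ ≠ 0) (h : φ * ψ = χ) :
    ∃ a b, a + b = n ∧ IsWeightedHomogeneous w φ a ∧ IsWeightedHomogeneous w ψ b := by
  have hT : weightTracker w φ * weightTracker w ψ = Polynomial.monomial n χ := by
    rw [← map_mul, h, isWeightedHomogeneous_iff_weightTracker.mp hχ]
  have hne : weightTracker w φ * weightTracker w ψ ≠ 0 := by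
    rw [hT]; simpa using h0
  have hφ := left_ne_zero_of_mul hne
  have hψ := right_ne_zero_of_mul hne
  have h1 := Polynomial.natDegree_mul hφ hψ
  have h2 := Polynomial.natTrailingDegree_mul hφ hψ
  rw [hT, Polynomial.natDegree_monomial_eq _ h0] at h1
  rw [hT, Polynomial.natTrailingDegree_monomial h0] at h2
  have h3 := Polynomial.natTrailingDegree_le_natDegree (weightTracker w φ)
  have h4 := Polynomial.natTrailingDegree_le_natDegree (weightTracker w ψ)
  -- A polynomial whose degree and trailing degree agree is a monomial.
  have key : ∀ x : MvPolynomial σ R,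
      (weightTracker w x).natDegree = (weightTracker w x).natTrailingDegree →
      IsWeightedHomogeneous w x (weightTracker w x).natDegree := by
    intro x hx
    have hc : ∀ m, m ≠ (weightTracker w x).natDegree → weightedHomogeneousComponent w m x = 0 := by
      intro m hm
      rw [← coeff_weightTracker]
      rcases lt_or_gt_of_ne hm with hm | hm
      · exact Polynomial.coeff_eq_zero_of_lt_natTrailingDegree (hx ▸ hm)
      · exact Polynomial.coeff_eq_zero_of_natDegree_lt hm
    have hs := sum_weightedHomogeneousComponent w x
    rw [finsum_eq_single _ _ hc] at hs
    rw [← hs]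
    convert weightedHomogeneousComponent_isWeightedHomogeneous _ x using 1
    rw [hs]
  exact ⟨_, _, h1.symm, key φ (by omega), key ψ (by omega)⟩

end MvPolynomial

/-! ### Polynomials in two variables of weights `4` and `6` -/

/-- The weights `4` and `6` of the two generators of the graded ring of modular forms. -/
def eisensteinWeight : Fin 2 → ℕ := ![4, 6]

namespace MvPolynomial

lemma weight_eisensteinWeight (d : Fin 2 →₀ ℕ) :
    Finsupp.weight eisensteinWeight d = 4 * d 0 + 6 * d 1 := by
  simp [Finsupp.weight_apply, Finsupp.sum_fintype, eisensteinWeight, mul_comm]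

variable {K : Type*} [Field K]

lemma monomial_eq_X_zero_pow_mul_X_one_pow (d : Fin 2 →₀ ℕ) (r : K) :
    (monomial d r : MvPolynomial (Fin 2) K) = C r * (X 0 ^ d 0 * X 1 ^ d 1) := by
  rw [monomial_eq, Finsupp.prod_fintype _ _ (by simp), Fin.prod_univ_two]

lemma isWeightedHomogeneous_X_zero :
    IsWeightedHomogeneous eisensteinWeight (X 0 : MvPolynomial (Fin 2) K) 4 :=
  isWeightedHomogeneous_X K eisensteinWeight 0

lemma isWeightedHomogeneous_X_one :
    IsWeightedHomogeneous eisensteinWeight (X 1 : MvPolynomial (Fin 2) K) 6 :=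
  isWeightedHomogeneous_X K eisensteinWeight 1

lemma isWeightedHomogeneous_X_pow_mul_X_pow (a b : ℕ) :
    IsWeightedHomogeneous eisensteinWeight (X 0 ^ a * X 1 ^ b : MvPolynomial (Fin 2) K)
      (4 * a + 6 * b) := by
  convert (isWeightedHomogeneous_X_zero.pow a).mul (isWeightedHomogeneous_X_one.pow b) using 1
  simp [mul_comm]

/-- A property of pairs (polynomial, weight) that holds for constants and for the two generators,
and that is stable under sums of equal weight and under products, holds for all weighted
homogeneous polynomials. -/
lemma IsWeightedHomogeneous.induction_eisensteinWeight {motive : MvPolynomial (Fin 2) K → ℕ → Prop}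
    (zero : ∀ k, motive 0 k) (C : ∀ c, motive (C c) 0) (X_zero : motive (X 0) 4)
    (X_one : motive (X 1) 6)
    (add : ∀ φ ψ k, motive φ k → motive ψ k → motive (φ + ψ) k)
    (mul : ∀ φ ψ k l, motive φ k → motive ψ l → motive (φ * ψ) (k + l))
    {φ : MvPolynomial (Fin 2) K} {k : ℕ} (h : IsWeightedHomogeneous eisensteinWeight φ k) :
    motive φ k := by
  have pow : ∀ ψ l, motive ψ l → ∀ n, motive (ψ ^ n) (l * n) := by
    intro ψ l hψ n
    induction n with
    | zero => simpa using C 1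
    | succ n ih => simpa [pow_succ, mul_add] using mul _ _ _ _ ih hψ
  induction h using IsWeightedHomogeneous.induction_on with
  | zero => exact zero k
  | add p q _ _ hp hq => exact add p q k hp hq
  | monomial d r hr =>
    rw [weight_eisensteinWeight] at hr
    rw [monomial_eq_X_zero_pow_mul_X_one_pow, ← hr, ← zero_add (4 * d 0 + 6 * d 1)]
    exact mul _ _ _ _ (C r) (mul _ _ _ _ (pow _ _ X_zero _) (pow _ _ X_one _))

/-- The derivation `Q ↦ -4 R`, `R ↦ -6 Q ^ 2` of `K[Q, R]`: twelve times the Serre derivative in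
terms of `Q = E₄` and `R = E₆`. -/
noncomputable def serreDerivation (K : Type*) [Field K] :
    Derivation K (MvPolynomial (Fin 2) K) (MvPolynomial (Fin 2) K) :=
  mkDerivation K ![-4 * X 1, -6 * X 0 ^ 2]

@[simp] lemma serreDerivation_X_zero : serreDerivation K (X 0) = -4 * X 1 := by
  simp [serreDerivation, mkDerivation_X]

@[simp] lemma serreDerivation_X_one : serreDerivation K (X 1) = -6 * X 0 ^ 2 := by
  simp [serreDerivation, mkDerivation_X]

@[simp] lemma serreDerivation_C (c : K) : serreDerivation K (C c) = 0 := by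
  simp [serreDerivation]

lemma IsWeightedHomogeneous.serreDerivation {φ : MvPolynomial (Fin 2) K} {k : ℕ}
    (h : IsWeightedHomogeneous eisensteinWeight φ k) :
    IsWeightedHomogeneous eisensteinWeight (serreDerivation K φ) (k + 2) := by
  suffices H : IsWeightedHomogeneous eisensteinWeight φ k ∧
      IsWeightedHomogeneous eisensteinWeight (MvPolynomial.serreDerivation K φ) (k + 2) from H.2
  refine IsWeightedHomogeneous.induction_eisensteinWeight
    (motive := fun φ k ↦ IsWeightedHomogeneous eisensteinWeight φ k ∧
      IsWeightedHomogeneous eisensteinWeight (MvPolynomial.serreDerivation K φ) (k + 2))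
    ?_ ?_ ?_ ?_ ?_ ?_ h
  · exact fun k ↦ ⟨isWeightedHomogeneous_zero _ _ _, by
      rw [map_zero]; exact isWeightedHomogeneous_zero _ _ _⟩
  · exact fun c ↦ ⟨isWeightedHomogeneous_C _ _, by
      rw [serreDerivation_C]; exact isWeightedHomogeneous_zero _ _ _⟩
  · refine ⟨isWeightedHomogeneous_X_zero, ?_⟩
    rw [serreDerivation_X_zero]
    rw [show (-4 : MvPolynomial (Fin 2) K) = C (-4) by simp [map_ofNat]]
    exact isWeightedHomogeneous_X_one.C_mul (-4 : K)
  · refine ⟨isWeightedHomogeneous_X_one, ?_⟩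
    rw [serreDerivation_X_one]
    rw [show (-6 : MvPolynomial (Fin 2) K) = C (-6) by simp [map_ofNat]]
    exact (isWeightedHomogeneous_X_zero.pow 2).C_mul (-6 : K)
  · rintro φ ψ k ⟨h1, h2⟩ ⟨h3, h4⟩
    exact ⟨h1.add h3, by rw [map_add]; exact h2.add h4⟩
  · rintro φ ψ k l ⟨h1, h2⟩ ⟨h3, h4⟩
    refine ⟨h1.mul h3, ?_⟩
    rw [Derivation.leibniz, smul_eq_mul, smul_eq_mul]
    refine IsWeightedHomogeneous.add ?_ ?_
    · exact h1.mul h4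
    · convert h3.mul h2 using 1; omega

lemma IsWeightedHomogeneous.eq_C {φ : MvPolynomial (Fin 2) K}
    (h : IsWeightedHomogeneous eisensteinWeight φ 0) : ∃ c, φ = C c := by
  induction h using IsWeightedHomogeneous.induction_on with
  | zero => exact ⟨0, by simp⟩
  | add p q _ _ hp hq =>
    obtain ⟨⟨a, rfl⟩, b, rfl⟩ := And.intro hp hq
    exact ⟨a + b, by simp⟩
  | monomial d r hr =>
    rw [weight_eisensteinWeight] at hr
    refine ⟨r, ?_⟩
    rw [monomial_eq_X_zero_pow_mul_X_one_pow, show d 0 = 0 by omega, show d 1 = 0 by omega]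
    simp

lemma IsWeightedHomogeneous.eq_zero_of_weight_two {φ : MvPolynomial (Fin 2) K}
    (h : IsWeightedHomogeneous eisensteinWeight φ 2) : φ = 0 := by
  refine h.eq_zero_of_no_monomials fun d hd ↦ ?_
  rw [weight_eisensteinWeight] at hd
  omega

lemma IsWeightedHomogeneous.eq_of_weight_four {φ : MvPolynomial (Fin 2) K}
    (h : IsWeightedHomogeneous eisensteinWeight φ 4) : ∃ c, φ = C c * X 0 := by
  induction h using IsWeightedHomogeneous.induction_on with
  | zero => exact ⟨0, by simp⟩
  | add p q _ _ hp hq =>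
    obtain ⟨⟨a, rfl⟩, b, rfl⟩ := And.intro hp hq
    exact ⟨a + b, by simp [add_mul]⟩
  | monomial d r hr =>
    rw [weight_eisensteinWeight] at hr
    refine ⟨r, ?_⟩
    rw [monomial_eq_X_zero_pow_mul_X_one_pow, show d 0 = 1 by omega, show d 1 = 0 by omega]
    simp

/-- Two monomials of the same weight are congruent modulo `Q ^ 3 - R ^ 2`. -/
lemma X_cube_sub_X_sq_dvd_sub {a b a' b' : ℕ} (h : 4 * a + 6 * b = 4 * a' + 6 * b') :
    (X 0 ^ 3 - X 1 ^ 2 : MvPolynomial (Fin 2) K) ∣ X 0 ^ a * X 1 ^ b - X 0 ^ a' * X 1 ^ b' := by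
  have key : ∀ a b m : ℕ, (X 0 ^ 3 - X 1 ^ 2 : MvPolynomial (Fin 2) K) ∣
      X 0 ^ (a + 3 * m) * X 1 ^ b - X 0 ^ a * X 1 ^ (b + 2 * m) := by
    intro a b m
    have := (sub_dvd_pow_sub_pow (X 0 ^ 3 : MvPolynomial (Fin 2) K) (X 1 ^ 2) m).mul_left
      (X 0 ^ a * X 1 ^ b)
    convert this using 1
    ring
  rcases le_total a' a with hle | hle
  · obtain ⟨m, rfl⟩ : ∃ m, a = a' + 3 * m := ⟨(a - a') / 3, by omega⟩
    obtain rfl : b' = b + 2 * m := by omega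
    exact key _ _ _
  · obtain ⟨m, rfl⟩ : ∃ m, a' = a + 3 * m := ⟨(a' - a) / 3, by omega⟩
    obtain rfl : b = b' + 2 * m := by omega
    rw [← dvd_neg, neg_sub]
    exact key _ _ _

/-- Modulo `Q ^ 3 - R ^ 2` the forms of a given weight are spanned by any monomial of that
weight. -/
lemma IsWeightedHomogeneous.exists_X_cube_sub_X_sq_dvd {φ : MvPolynomial (Fin 2) K} {a b k : ℕ}
    (h : IsWeightedHomogeneous eisensteinWeight φ k) (hab : 4 * a + 6 * b = k) :
    ∃ c, (X 0 ^ 3 - X 1 ^ 2 : MvPolynomial (Fin 2) K) ∣ φ - C c * (X 0 ^ a * X 1 ^ b) := by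
  induction h using IsWeightedHomogeneous.induction_on with
  | zero => exact ⟨0, by simp⟩
  | add p q _ _ hp hq =>
    obtain ⟨⟨c, hc⟩, d, hd⟩ := And.intro hp hq
    refine ⟨c + d, ?_⟩
    convert hc.add hd using 1
    rw [C_add]; ring
  | monomial d r hr =>
    rw [weight_eisensteinWeight, ← hab] at hr
    refine ⟨r, ?_⟩
    rw [monomial_eq_X_zero_pow_mul_X_one_pow, ← mul_sub]
    exact (X_cube_sub_X_sq_dvd_sub hr).mul_left _

end MvPolynomial

/-! ### Power series with Ramanujan's differential equations -/

namespace PowerSeries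

/-- The operator `θ = q d/dq` on power series. -/
noncomputable def theta (S : Type*) [CommRing S] : Derivation S (PowerSeries S) (PowerSeries S) :=
  (X : PowerSeries S) • derivative S

lemma coeff_theta {S : Type*} [CommRing S] (f : PowerSeries S) (n : ℕ) :
    (theta S f).coeff n = n * f.coeff n := by
  cases n with
  | zero => simp [theta]
  | succ n => simp [theta, coeff_succ_X_mul, coeff_derivative, mul_comm]

lemma constantCoeff_theta {S : Type*} [CommRing S] (f : PowerSeries S) :
    constantCoeff (theta S f) = 0 := by
  rw [← coeff_zero_eq_constantCoeff_apply, coeff_theta]; simp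

lemma map_theta {S T : Type*} [CommRing S] [CommRing T] (φ : S →+* T) (f : PowerSeries S) :
    map φ (theta S f) = theta T (map φ f) := by
  ext n; simp [coeff_theta]

lemma coeff_theta_iterate {S : Type*} [CommRing S] (f : PowerSeries S) (n j : ℕ) :
    ((theta S)^[j] f).coeff n = n ^ j * f.coeff n := by
  induction j with
  | zero => simp
  | succ j ih => rw [Function.iterate_succ_apply', coeff_theta, ih, pow_succ']; ring

end PowerSeries

open PowerSeries (theta coeff_theta constantCoeff_theta)

/-- Three power series with constant term `1` satisfying Ramanujan's differential equations for the
`q`-expansions of `E₂`, `E₄` and `E₆`, normalized by `Q ^ 3 - R ^ 2 = 1728 q + ⋯`. -/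
structure RamanujanTriple (S : Type*) [CommRing S] where
  /-- The series playing the role of `E₂`. -/
  P : PowerSeries S
  /-- The series playing the role of `E₄`. -/
  Q : PowerSeries S
  /-- The series playing the role of `E₆`. -/
  R : PowerSeries S
  constantCoeff_P : P.constantCoeff = 1
  constantCoeff_Q : Q.constantCoeff = 1
  constantCoeff_R : R.constantCoeff = 1
  theta_P : 12 * theta S P = P ^ 2 - Q
  theta_Q : 3 * theta S Q = P * Q - R
  theta_R : 2 * theta S R = P * R - Q ^ 2
  coeff_one : (Q ^ 3 - R ^ 2).coeff 1 = 1728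

namespace RamanujanTriple

/-- The image of a Ramanujan triple under a change of coefficients. -/
noncomputable def map {S T : Type*} [CommRing S] [CommRing T] (E : RamanujanTriple S)
    (φ : S →+* T) : RamanujanTriple T where
  P := E.P.map φ
  Q := E.Q.map φ
  R := E.R.map φ
  constantCoeff_P := by
    rw [← PowerSeries.coeff_zero_eq_constantCoeff_apply, PowerSeries.coeff_map,
      PowerSeries.coeff_zero_eq_constantCoeff_apply, E.constantCoeff_P, map_one]
  constantCoeff_Q := by
    rw [← PowerSeries.coeff_zero_eq_constantCoeff_apply, PowerSeries.coeff_map,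
      PowerSeries.coeff_zero_eq_constantCoeff_apply, E.constantCoeff_Q, map_one]
  constantCoeff_R := by
    rw [← PowerSeries.coeff_zero_eq_constantCoeff_apply, PowerSeries.coeff_map,
      PowerSeries.coeff_zero_eq_constantCoeff_apply, E.constantCoeff_R, map_one]
  theta_P := by simpa [PowerSeries.map_theta, map_ofNat] using congr(PowerSeries.map φ $(E.theta_P))
  theta_Q := by simpa [PowerSeries.map_theta, map_ofNat] using congr(PowerSeries.map φ $(E.theta_Q))
  theta_R := by simpa [PowerSeries.map_theta, map_ofNat] using congr(PowerSeries.map φ $(E.theta_R))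
  coeff_one := by
    rw [← map_pow, ← map_pow, ← map_sub, PowerSeries.coeff_map, E.coeff_one, map_ofNat]

open MvPolynomial

variable {K : Type*} [Field K] (E : RamanujanTriple K)

/-- The `q`-expansion of a polynomial in `Q` and `R`. -/
noncomputable def eval : MvPolynomial (Fin 2) K →ₐ[K] PowerSeries K :=
  aeval ![E.Q, E.R]

@[simp] lemma eval_X_zero : E.eval (X 0) = E.Q := by simp [eval]

@[simp] lemma eval_X_one : E.eval (X 1) = E.R := by simp [eval]

@[simp] lemma eval_C (c : K) : E.eval (C c) = PowerSeries.C c := by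
  simp [eval]

/-- `q d/dq` in terms of the Serre derivation: `12 θ f = ∂ f + k P f` in weight `k`. -/
lemma theta_eval {φ : MvPolynomial (Fin 2) K} {k : ℕ}
    (h : IsWeightedHomogeneous eisensteinWeight φ k) :
    12 * theta K (E.eval φ) = E.eval (serreDerivation K φ) + k * E.P * E.eval φ := by
  refine IsWeightedHomogeneous.induction_eisensteinWeight (motive := fun φ k ↦
    12 * theta K (E.eval φ) = E.eval (serreDerivation K φ) + k * E.P * E.eval φ)
    ?_ ?_ ?_ ?_ ?_ ?_ h
  · simp
  · intro c
    have : theta K (PowerSeries.C c) = 0 := by simp [theta]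
    simp [this]
  · simp only [eval_X_zero, serreDerivation_X_zero, map_mul, map_neg, map_ofNat, eval_X_one]
    push_cast
    linear_combination 4 * E.theta_Q
  · simp only [eval_X_zero, serreDerivation_X_one, map_mul, map_neg, map_ofNat, eval_X_one, map_pow]
    push_cast
    linear_combination 6 * E.theta_R
  · intro φ ψ k h1 h2
    simp only [map_add]
    linear_combination h1 + h2
  · intro φ ψ k l h1 h2
    simp only [map_mul, Derivation.leibniz, smul_eq_mul, map_add]
    push_cast
    linear_combination E.eval φ * h2 + E.eval ψ * h1

/-- A weighted homogeneous polynomial is determined by its weight and its `q`-expansion. -/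
lemma eq_zero_of_eval_eq_zero (h1728 : (1728 : K) ≠ 0) {φ : MvPolynomial (Fin 2) K} {k : ℕ}
    (h : IsWeightedHomogeneous eisensteinWeight φ k) (h0 : E.eval φ = 0) : φ = 0 := by
  induction k using Nat.strong_induction_on generalizing φ with
  | _ k ih =>
    by_contra hφ
    obtain ⟨d, hd⟩ := exists_coeff_ne_zero hφ
    have hab := h hd
    rw [weight_eisensteinWeight] at hab
    obtain ⟨c, ψ, hψ⟩ := h.exists_X_cube_sub_X_sq_dvd hab
    have hc : c = 0 := by
      have := congr(PowerSeries.constantCoeff (E.eval $hψ))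
      simpa [h0, E.constantCoeff_Q, E.constantCoeff_R] using this
    rw [hc, C_0, zero_mul, sub_zero] at hψ
    have hD : IsWeightedHomogeneous eisensteinWeight (X 0 ^ 3 - X 1 ^ 2 : MvPolynomial (Fin 2) K)
        12 := (isWeightedHomogeneous_X_zero.pow 3).sub (isWeightedHomogeneous_X_one.pow 2)
    have hD0 : E.eval (X 0 ^ 3 - X 1 ^ 2) ≠ 0 := by
      intro h'
      have := E.coeff_one
      simp only [map_sub, map_pow, eval_X_zero, eval_X_one] at h'
      rw [h'] at this
      exact h1728 (by simpa using this.symm)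
    obtain ⟨a, b, hab', ha, hb⟩ := h.exists_of_mul_eq hφ hψ.symm
    have ha12 : a = 12 := ha.inj_right (fun h' ↦ hD0 (by rw [h', map_zero])) hD
    have hψ0 : E.eval ψ = 0 := by
      have := congr(E.eval $hψ)
      rw [h0, map_mul] at this
      exact (mul_eq_zero.mp this.symm).resolve_left hD0
    exact hφ (by rw [hψ, ih b (by omega) hb hψ0, mul_zero])

lemma eq_of_eval_eq (h1728 : (1728 : K) ≠ 0) {φ ψ : MvPolynomial (Fin 2) K} {k : ℕ}
    (hφ : IsWeightedHomogeneous eisensteinWeight φ k)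
    (hψ : IsWeightedHomogeneous eisensteinWeight ψ k) (h : E.eval φ = E.eval ψ) : φ = ψ :=
  sub_eq_zero.mp (E.eq_zero_of_eval_eq_zero h1728 (hφ.sub hψ) (by rw [map_sub, h, sub_self]))

end RamanujanTriple

/-! ### Modular forms of weight `p - 1` modulo `p` -/

section

open PowerSeries (theta coeff_theta constantCoeff_theta)

/-- If `a` and `b` have no common factor, then whatever divides `a * x` and `b * x` divides `x`. -/
lemma IsRelPrime.dvd_of_dvd_mul_of_dvd_mul {α : Type*} [CommRing α] [IsDomain α]
    [DecompositionMonoid α] {a b d x : α} (h : IsRelPrime a b) (ha0 : a ≠ 0)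
    (ha : d ∣ a * x) (hb : d ∣ b * x) : d ∣ x := by
  rcases eq_or_ne d 0 with rfl | hd
  · rw [zero_dvd_iff] at ha ⊢
    exact (mul_eq_zero.mp ha).resolve_left ha0
  obtain ⟨s, hs⟩ := ha
  obtain ⟨t, ht⟩ := hb
  have hst : a * t = b * s := mul_left_cancel₀ hd (by linear_combination b * hs - a * ht)
  obtain ⟨s', rfl⟩ := h.dvd_of_dvd_mul_left (Dvd.intro _ hst)
  exact ⟨s', mul_left_cancel₀ ha0 (by linear_combination hs)⟩

namespace RamanujanTriple

open MvPolynomial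

variable {p : ℕ} [hp : Fact p.Prime]

lemma cast_sub_one_eq : ((p - 1 : ℕ) : ZMod p) = -1 := by
  rw [Nat.cast_sub hp.out.one_le]; simp

lemma natCast_ne_zero_of_pos_of_lt {n : ℕ} (h0 : 0 < n) (h : n < p) : (n : ZMod p) ≠ 0 := by
  rw [Ne, ZMod.natCast_eq_zero_iff]
  exact fun h' ↦ absurd (Nat.le_of_dvd h0 h') (by omega)

lemma twelve_ne_zero (hp3 : 3 < p) : (12 : ZMod p) ≠ 0 := by
  have h2 := natCast_ne_zero_of_pos_of_lt (p := p) (n := 2) (by omega) (by omega)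
  have h3 := natCast_ne_zero_of_pos_of_lt (p := p) (n := 3) (by omega) (by omega)
  rw [show (12 : ZMod p) = ((2 : ℕ) : ZMod p) ^ 2 * ((3 : ℕ) : ZMod p) by norm_num]
  exact mul_ne_zero (pow_ne_zero _ h2) h3

lemma seventeen_twenty_eight_ne_zero (hp3 : 3 < p) : (1728 : ZMod p) ≠ 0 := by
  rw [show (1728 : ZMod p) = 12 ^ 3 by norm_num]
  exact pow_ne_zero _ (twelve_ne_zero hp3)

variable (E : RamanujanTriple (ZMod p)) {A : MvPolynomial (Fin 2) (ZMod p)}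

/-- The Serre derivative of the Hasse invariant `A` reduces to `E₂`, as `A` has weight `-1` modulo
`p` and `θ` annihilates its `q`-expansion. -/
lemma eval_serreDerivation_hasse (hA : IsWeightedHomogeneous eisensteinWeight A (p - 1))
    (hA1 : E.eval A = 1) : E.eval (serreDerivation _ A) = E.P := by
  have h := E.theta_eval hA
  have h1 : ((p - 1 : ℕ) : PowerSeries (ZMod p)) = -1 := by
    rw [← map_natCast PowerSeries.C, cast_sub_one_eq]; simp
  rw [hA1, h1, Derivation.map_one_eq_zero] at h
  linear_combination -h

/-- The second Serre derivative of the Hasse invariant, from Ramanujan's equation for `θ E₂`. -/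
lemma serreDerivation_serreDerivation_hasse (hp3 : 3 < p)
    (hA : IsWeightedHomogeneous eisensteinWeight A (p - 1)) (hA1 : E.eval A = 1) :
    serreDerivation _ (serreDerivation _ A) = -(X 0 * A) := by
  have hB := eval_serreDerivation_hasse E hA hA1
  refine E.eq_of_eval_eq (seventeen_twenty_eight_ne_zero hp3) (k := p - 1 + 2 + 2)
    hA.serreDerivation.serreDerivation ?_ ?_
  · rw [show p - 1 + 2 + 2 = 4 + (p - 1) by omega]
    exact (isWeightedHomogeneous_X_zero.mul hA).neg
  · have h := E.theta_eval hA.serreDerivation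
    have h1 : ((p - 1 + 2 : ℕ) : PowerSeries (ZMod p)) = 1 := by
      rw [← map_natCast PowerSeries.C, Nat.cast_add, cast_sub_one_eq]
      norm_num
    rw [hB, h1] at h
    rw [map_neg, map_mul, hA1, eval_X_zero]
    linear_combination E.theta_P - h

/-- Igusa's theorem: `A` has no factor in common with its Serre derivative `B`. Since `∂ A = B`
and `∂ B = -Q A`, the greatest common divisor `D` divides `∂ D`, which for reasons of weight is then
`0`; comparing constant terms in `12 θ D = ∂ D + w P D`, the weight `w < p` of `D` is a multiple of
`p`, so that `D` is constant. -/
lemma isRelPrime_serreDerivation (hp3 : 3 < p)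
    (hA : IsWeightedHomogeneous eisensteinWeight A (p - 1)) (hA1 : E.eval A = 1) :
    IsRelPrime A (serreDerivation _ A) := by
  have hA0 : A ≠ 0 := by rintro rfl; simp at hA1
  have hBB := serreDerivation_serreDerivation_hasse E hp3 hA hA1
  obtain ⟨a, b, D, hab, hDa, hDb⟩ :=
    UniqueFactorizationMonoid.exists_reduced_factors A hA0 (serreDerivation _ A)
  have ha0 : a ≠ 0 := by rintro rfl; exact hA0 (by rw [← hDa, mul_zero])
  have hD0 : D ≠ 0 := by rintro rfl; exact hA0 (by rw [← hDa, zero_mul])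
  have hdvd : D ∣ serreDerivation _ D := by
    refine hab.dvd_of_dvd_mul_of_dvd_mul ha0 ⟨b - serreDerivation _ a, ?_⟩
      ⟨-(X 0 * a) - serreDerivation _ b, ?_⟩
    · have h : serreDerivation _ (D * a) = D * b := by rw [hDa, hDb]
      rw [Derivation.leibniz, smul_eq_mul, smul_eq_mul] at h
      linear_combination h
    · have h : serreDerivation _ (D * b) = -(X 0 * (D * a)) := by rw [hDb, hBB, hDa]
      rw [Derivation.leibniz, smul_eq_mul, smul_eq_mul] at h
      linear_combination h
  obtain ⟨w, v, hwv, hDw, -⟩ := hA.exists_of_mul_eq hA0 hDa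
  have hdD : serreDerivation _ D = 0 := by
    by_contra hne
    obtain ⟨c, hc⟩ := hdvd
    obtain ⟨w', v', hwv', hDw', hcv'⟩ := hDw.serreDerivation.exists_of_mul_eq hne hc.symm
    have : w' = w := hDw'.inj_right hD0 hDw
    obtain rfl : v' = 2 := by omega
    rw [hcv'.eq_zero_of_weight_two, mul_zero] at hc
    exact hne hc
  have hw : w = 0 := by
    have h := congr(PowerSeries.constantCoeff $(E.theta_eval hDw))
    have hD1 : PowerSeries.constantCoeff (E.eval D) ≠ 0 := by
      intro h'
      have := congr(PowerSeries.constantCoeff (E.eval $hDa))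
      rw [map_mul, map_mul, h', hA1] at this
      simp at this
    rw [hdD, map_zero, zero_add, map_mul, constantCoeff_theta, mul_zero, map_mul, map_mul,
      E.constantCoeff_P, map_natCast, mul_one] at h
    by_contra hw0
    exact natCast_ne_zero_of_pos_of_lt (p := p) (n := w) (by omega) (by have := hp.out.pos; omega)
      ((mul_eq_zero.mp h.symm).resolve_right hD1)
  have hDu : IsUnit D := by
    rw [hw] at hDw
    obtain ⟨c, rfl⟩ := hDw.eq_C
    have hc : c ≠ 0 := by rintro rfl; exact hD0 C_0
    exact (IsUnit.mk0 c hc).map C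
  intro d hdA hdB
  rw [← hDa, hDu.dvd_mul_left] at hdA
  rw [← hDb, hDu.dvd_mul_left] at hdB
  exact hab hdA hdB

/-- Iterates of `12 θ` on a form `φ` of weight `k`, realized as forms of weight `k + j (p + 1)` by
means of `x ↦ A ∂ x + k B x`. Modulo `A` this map is multiplication by `k B`; as `A` and `B` are
relatively prime, `A` cannot divide an iterate unless it divides `φ`, as long as the weight stays
prime to `p`. -/
lemma exists_eval_eq_theta_iterate (hp3 : 3 < p)
    (hA : IsWeightedHomogeneous eisensteinWeight A (p - 1)) (hA1 : E.eval A = 1)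
    {φ : MvPolynomial (Fin 2) (ZMod p)} {k : ℕ} (hφ : IsWeightedHomogeneous eisensteinWeight φ k)
    (j : ℕ) (hj : ∀ i < j, ((k + i : ℕ) : ZMod p) ≠ 0) :
    ∃ ψ, IsWeightedHomogeneous eisensteinWeight ψ (k + j * (p + 1)) ∧
      E.eval ψ = 12 ^ j * (theta _)^[j] (E.eval φ) ∧ (A ∣ ψ → A ∣ φ) := by
  have hp0 := hp.out.pos
  induction j with
  | zero => exact ⟨φ, by simpa using hφ, by simp, id⟩
  | succ j ih =>
    obtain ⟨ψ, hψ, hev, hdvd⟩ := ih fun i hi ↦ hj i (by omega)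
    have hcast : ((k + j * (p + 1) : ℕ) : ZMod p) = (k + j : ℕ) := by push_cast; simp
    refine ⟨A * serreDerivation _ ψ + C ((k + j : ℕ) : ZMod p) * (serreDerivation _ A * ψ),
      ?_, ?_, ?_⟩
    · refine IsWeightedHomogeneous.add ?_ (IsWeightedHomogeneous.C_mul ?_ _)
      · convert hA.mul hψ.serreDerivation using 1
        rw [add_mul]; omega
      · convert hA.serreDerivation.mul hψ using 1
        rw [add_mul]; omega
    · have h := E.theta_eval hψ
      rw [← map_natCast PowerSeries.C, hcast] at h
      have h2 : (12 : PowerSeries (ZMod p)) * theta _ (E.eval ψ) =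
          12 ^ (j + 1) * (theta _)^[j + 1] (E.eval φ) := by
        have h12 : theta (ZMod p) (12 ^ j) = 0 := by
          have : (12 ^ j : PowerSeries (ZMod p)) = ((12 ^ j : ℕ) : PowerSeries (ZMod p)) := by
            push_cast; rfl
          rw [this]; exact Derivation.map_natCast _ _
        rw [hev, Derivation.leibniz, Function.iterate_succ_apply', h12]
        simp only [smul_eq_mul]
        ring
      rw [← h2, h, map_add, map_mul, map_mul, map_mul, hA1,
        eval_serreDerivation_hasse E hA hA1, eval_C]
      ring
    · intro hdiv
      apply hdvd
      have h1 := (dvd_add_right (Dvd.intro _ rfl)).mp hdiv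
      have hu : IsUnit (C ((k + j : ℕ) : ZMod p) : MvPolynomial (Fin 2) (ZMod p)) :=
        (IsUnit.mk0 _ (hj j (by omega))).map C
      rw [hu.dvd_mul_left] at h1
      exact (isRelPrime_serreDerivation E hp3 hA hA1).dvd_of_dvd_mul_left h1

/-- A form `φ` of weight `p - 1` modulo `p` whose coefficients at all multiples of `p` vanish is
zero. With `θ ^ 2 φ` being a form of weight `p + 3` and `θ ^ (p - 1) φ = φ`, the iterate
`θ ^ (p - 3) (θ ^ 2 φ)` is divisible by `A`, hence so is `θ ^ 2 φ`; the quotient has weight `4`. -/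
theorem eval_eq_zero_of_coeff_mul_eq_zero (hp3 : 3 < p)
    (hA : IsWeightedHomogeneous eisensteinWeight A (p - 1)) (hA1 : E.eval A = 1)
    {φ : MvPolynomial (Fin 2) (ZMod p)} (hφ : IsWeightedHomogeneous eisensteinWeight φ (p - 1))
    (h : ∀ n, (E.eval φ).coeff (p * n) = 0) : E.eval φ = 0 := by
  have hp0 := hp.out.pos
  have hm1 : ((p - 1 : ℕ) : PowerSeries (ZMod p)) = -1 := by
    rw [← map_natCast PowerSeries.C, cast_sub_one_eq]; simp
  have h1 : ((p - 1 + 2 : ℕ) : PowerSeries (ZMod p)) = 1 := by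
    rw [Nat.cast_add, hm1]; norm_num
  -- In weight `-1` the operator `θ ^ 2` preserves modularity, without a correction term in `P`.
  set γ := serreDerivation _ (serreDerivation _ φ) + X 0 * φ with hγ_def
  have hγ : IsWeightedHomogeneous eisensteinWeight γ (p + 3) := by
    refine IsWeightedHomogeneous.add ?_ ?_
    · convert hφ.serreDerivation.serreDerivation using 1
      omega
    · convert isWeightedHomogeneous_X_zero.mul hφ using 1
      omega
  have hevγ : E.eval γ = 144 * theta _ (theta _ (E.eval φ)) := by
    have e1 := E.theta_eval hφ
    have e2 := E.theta_eval hφ.serreDerivation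
    rw [hm1] at e1
    rw [h1] at e2
    have e3 := congr(theta _ $e1)
    have h12 : theta (ZMod p) (12 : PowerSeries (ZMod p)) = 0 := by
      exact_mod_cast Derivation.map_natCast (theta (ZMod p)) 12
    simp only [Derivation.leibniz, smul_eq_mul, map_add, h12, neg_mul, one_mul, map_neg] at e3
    rw [hγ_def, map_add, map_mul, eval_X_zero]
    linear_combination -12 * e3 - e2 + E.eval φ * E.theta_P + E.P * e1
  obtain ⟨ψ, hψ, hevψ, hdvd⟩ := E.exists_eval_eq_theta_iterate hp3 hA hA1 hγ (p - 3) (by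
    intro i hi
    rw [show p + 3 + i = p + (3 + i) by ring, Nat.cast_add, CharP.cast_eq_zero, zero_add]
    exact natCast_ne_zero_of_pos_of_lt (by omega) (by omega))
  -- `θ ^ (p - 1)` fixes the `q`-expansion of `φ`, as the coefficients at multiples of `p` vanish.
  have hev : E.eval ψ = E.eval φ := by
    rw [hevψ, hevγ]
    ext n
    have e : (12 ^ (p - 3) * (theta (ZMod p))^[p - 3]
        (144 * theta _ (theta _ (E.eval φ)))).coeff n =
        12 ^ (p - 1) * (n ^ (p - 1) * (E.eval φ).coeff n) := by
      have c1 : (12 ^ (p - 3) : PowerSeries (ZMod p)) = PowerSeries.C (12 ^ (p - 3)) := by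
        simp [map_ofNat]
      have c2 : (144 : PowerSeries (ZMod p)) = PowerSeries.C 144 := by simp [map_ofNat]
      rw [c1, c2, PowerSeries.coeff_C_mul, PowerSeries.coeff_theta_iterate,
        PowerSeries.coeff_C_mul, coeff_theta, coeff_theta]
      obtain ⟨m, rfl⟩ : ∃ m, p = m + 3 := ⟨p - 3, by omega⟩
      rw [show m + 3 - 3 = m by omega, show m + 3 - 1 = m + 2 by omega]
      ring
    rw [e, ZMod.pow_card_sub_one_eq_one (twelve_ne_zero hp3), one_mul]
    by_cases hn : p ∣ n
    · obtain ⟨m, rfl⟩ := hn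
      rw [h m, mul_zero]
    · rw [ZMod.pow_card_sub_one_eq_one, one_mul]
      rwa [Ne, ZMod.natCast_eq_zero_iff]
  have hψA : ψ = φ * A ^ (p - 1) := by
    refine E.eq_of_eval_eq (seventeen_twenty_eight_ne_zero hp3) hψ ?_ ?_
    · convert hφ.mul (hA.pow (p - 1)) using 1
      obtain ⟨m, rfl⟩ : ∃ m, p = m + 3 := ⟨p - 3, by omega⟩
      rw [show m + 3 - 3 = m by omega, show m + 3 - 1 = m + 2 by omega, smul_eq_mul]
      ring
    · rw [map_mul, map_pow, hA1, one_pow, mul_one, hev]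
  obtain ⟨χ, hχ⟩ : A ∣ γ := hdvd (by
    rw [hψA]
    exact (dvd_pow_self A (by omega)).mul_left φ)
  -- The quotient of weight `4` is a multiple of `Q`, and the multiple is `0` by its constant term.
  have hγ0 : E.eval γ = 0 := by
    by_contra hne
    have hγne : γ ≠ 0 := by intro h'; exact hne (by rw [h', map_zero])
    have hA0 : A ≠ 0 := by rintro rfl; simp at hA1
    obtain ⟨a, b, hab, hAa, hχb⟩ := hγ.exists_of_mul_eq hγne hχ.symm
    have : a = p - 1 := hAa.inj_right hA0 hA
    obtain rfl : b = 4 := by omega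
    obtain ⟨c, rfl⟩ := hχb.eq_of_weight_four
    have hev4 : E.eval γ = PowerSeries.C c * E.Q := by
      rw [hχ, map_mul, hA1, one_mul, map_mul, eval_C, eval_X_zero]
    have hc := congr(PowerSeries.constantCoeff $hev4)
    rw [hevγ, map_mul, constantCoeff_theta, mul_zero, map_mul, E.constantCoeff_Q, mul_one,
      PowerSeries.constantCoeff_C] at hc
    exact hne (by rw [hev4, ← hc, map_zero, zero_mul])
  ext n
  rw [map_zero]
  by_cases hn : p ∣ n
  · obtain ⟨m, rfl⟩ := hn
    exact h m
  · have hn0 : (n : ZMod p) ≠ 0 := by rwa [Ne, ZMod.natCast_eq_zero_iff]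
    have := congr(PowerSeries.coeff n $(hevγ.symm.trans hγ0))
    have c2 : (144 : PowerSeries (ZMod p)) = PowerSeries.C (12 ^ 2) := by
      rw [map_pow, map_ofNat]; norm_num
    rw [c2, PowerSeries.coeff_C_mul, coeff_theta, coeff_theta, map_zero] at this
    simpa [hn0, twelve_ne_zero hp3] using this

end RamanujanTriple

end

/-! ### Functions with a `q`-expansion -/

section

open UpperHalfPlane ModularForm Function Filter Complex
open scoped Derivative Manifold Topology Real

lemma UpperHalfPlane.periodic_of_hasSum_qParam {F : ℍ → ℂ} {c : ℕ → ℂ}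
    (h : ∀ τ : ℍ, HasSum (fun m ↦ c m • Periodic.qParam 1 τ ^ m) (F τ)) :
    Periodic (F ∘ ofComplex) 1 := by
  intro w
  rcases lt_or_ge 0 w.im with hw | hw
  · have hw' : 0 < (w + 1).im := by simpa using hw
    have h1 := h ⟨w, hw⟩
    have h2 := h ⟨w + 1, hw'⟩
    have hq : Periodic.qParam 1 (w + 1) = Periodic.qParam 1 w := by
      simp [Periodic.qParam, mul_add, Complex.exp_add]
    simp only [comp_apply, ofComplex_apply_of_im_pos hw, ofComplex_apply_of_im_pos hw']
    simp only [hq] at h2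
    exact h2.unique h1
  · have hw' : (w + 1).im ≤ 0 := by simpa using hw
    simp only [comp_apply, ofComplex_apply_of_im_nonpos hw, ofComplex_apply_of_im_nonpos hw']

/-- Termwise differentiation of a `q`-expansion. -/
lemma UpperHalfPlane.hasSum_normalizedDerivOfComplex {F : ℍ → ℂ} {c : ℕ → ℂ}
    (h : ∀ τ : ℍ, HasSum (fun m ↦ c m • Periodic.qParam 1 τ ^ m) (F τ)) (τ : ℍ) :
    HasSum (fun m : ℕ ↦ ((m : ℂ) * c m) • Periodic.qParam 1 τ ^ m) (D F τ) := by
  set y : ℝ := τ.im / 2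
  have hy : 0 < y := half_pos τ.im_pos
  set U : Set ℂ := {w | y < w.im}
  have hU : IsOpen U := isOpen_lt continuous_const Complex.continuous_im
  have hτU : (τ : ℂ) ∈ U := half_lt_self τ.im_pos
  have hnorm : ∀ w : ℂ, ‖Periodic.qParam 1 w‖ = Real.exp (-2 * π * w.im) := by
    intro w; rw [Periodic.norm_qParam]; simp
  have hsum : Summable fun m ↦
      ‖c m • Periodic.qParam 1 (⟨y * Complex.I, by simpa using hy⟩ : ℍ) ^ m‖ :=
    (h _).summable.norm
  have hd : ∀ (m : ℕ) (w : ℂ), HasDerivAt (fun w ↦ c m • Periodic.qParam 1 w ^ m)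
      (2 * π * Complex.I * ((m * c m) • Periodic.qParam 1 w ^ m)) w := by
    intro m w
    have h1 : HasDerivAt (Periodic.qParam 1) (Periodic.qParam 1 w * (2 * π * Complex.I)) w := by
      have : HasDerivAt (fun w : ℂ ↦ 2 * π * Complex.I * w / ((1 : ℝ) : ℂ))
          (2 * π * Complex.I) w := by
        simpa using (hasDerivAt_id w).const_mul (2 * π * Complex.I)
      exact this.cexp
    refine ((h1.pow m).const_mul (c m)).congr_deriv ?_
    rcases m with _ | m
    · simp
    · simp only [smul_eq_mul, Nat.add_sub_cancel]; ring
  -- On the half plane `y < im w` the series is dominated by its terms at `i y`.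
  have key := hasSum_deriv_of_summable_norm (F := fun m w ↦ c m • Periodic.qParam 1 w ^ m) hsum
    (fun m w _ ↦ (hd m w).differentiableAt.differentiableWithinAt) hU
    (fun m w hw ↦ by
      simp only [norm_smul, norm_pow, hnorm]
      gcongr ?_ * Real.exp ?_ ^ _
      have h1 : y < w.im := hw
      have h2 := Real.pi_pos
      have h3 : ((y : ℂ) * Complex.I).im = y := by simp
      rw [h3]
      nlinarith) hτU
  have hev : (fun w ↦ ∑' m, c m • Periodic.qParam 1 w ^ m) =ᶠ[𝓝 (τ : ℂ)] F ∘ ofComplex := by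
    filter_upwards [hU.mem_nhds hτU] with w hw
    have hw0 : 0 < w.im := hy.trans hw
    simp only [comp_apply, ofComplex_apply_of_im_pos hw0]
    exact (h ⟨w, hw0⟩).tsum_eq
  rw [hev.deriv_eq] at key
  have := key.mul_left (2 * π * Complex.I)⁻¹
  refine HasSum.congr_fun this fun m ↦ ?_
  rw [(hd m _).deriv, ← mul_assoc, inv_mul_cancel₀ two_pi_I_ne_zero, one_mul]

/-- Holomorphic functions on the upper half plane that are `1`-periodic and bounded at `i∞`: those
that are given by a `q`-expansion. -/
structure HasQExpansion (F : ℍ → ℂ) : Prop where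
  mdiff : MDiff F
  periodic : Periodic (F ∘ ofComplex) 1
  bdd : IsBoundedAtImInfty F

namespace HasQExpansion

variable {F G : ℍ → ℂ}

lemma analyticAt (hF : HasQExpansion F) : AnalyticAt ℂ (cuspFunction 1 F) 0 :=
  analyticAt_cuspFunction_zero one_pos (by simpa using hF.periodic) hF.mdiff hF.bdd

lemma hasSum (hF : HasQExpansion F) (τ : ℍ) :
    HasSum (fun m ↦ (qExpansion 1 F).coeff m • Periodic.qParam 1 τ ^ m) (F τ) :=
  hasSum_qExpansion one_pos (by simpa using hF.periodic) hF.mdiff hF.bdd τ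

lemma of_hasSum (hF : MDiff F) {c : ℕ → ℂ}
    (h : ∀ τ : ℍ, HasSum (fun m ↦ c m • Periodic.qParam 1 τ ^ m) (F τ)) : HasQExpansion F :=
  ⟨hF, periodic_of_hasSum_qParam h, isBoundedAtImInfty_of_hasSum_qExpansion one_pos h⟩

/-- The coefficients of a convergent `q`-expansion are those of `qExpansion`. -/
lemma coeff_unique (hF : HasQExpansion F) {c : ℕ → ℂ}
    (h : ∀ τ : ℍ, HasSum (fun m ↦ c m • Periodic.qParam 1 τ ^ m) (F τ)) (m : ℕ) :
    (qExpansion 1 F).coeff m = c m := by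
  have h1 := (hasFPowerSeriesOnBall_cuspFunction one_pos hF.analyticAt h).hasFPowerSeriesAt
  have h2 := (hasFPowerSeriesOnBall_cuspFunction one_pos hF.analyticAt hF.hasSum).hasFPowerSeriesAt
  simpa using congr_arg (FormalMultilinearSeries.coeff · m) (h2.eq_formalMultilinearSeries h1)

lemma of_modularForm {k : ℤ} (f : ModularForm 𝒮ℒ k) : HasQExpansion f where
  mdiff := f.holo'
  periodic := by
    simpa using SlashInvariantFormClass.periodic_comp_ofComplex f one_mem_strictPeriods_SL
  bdd := by
    have : Fact (IsCusp OnePoint.infty 𝒮ℒ) :=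
      ⟨Subgroup.isCusp_of_mem_strictPeriods one_pos one_mem_strictPeriods_SL⟩
    exact ModularFormClass.bdd_at_infty f

lemma mul (hF : HasQExpansion F) (hG : HasQExpansion G) : HasQExpansion (F * G) where
  mdiff := hF.mdiff.mul hG.mdiff
  periodic := hF.periodic.mul hG.periodic
  bdd := hF.bdd.mul hG.bdd

lemma sub (hF : HasQExpansion F) (hG : HasQExpansion G) : HasQExpansion (F - G) where
  mdiff := hF.mdiff.sub hG.mdiff
  periodic := hF.periodic.sub hG.periodic
  bdd := by
    rw [sub_eq_add_neg]
    exact BoundedAtFilter.add hF.bdd (BoundedAtFilter.neg hG.bdd)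

lemma smul (hF : HasQExpansion F) (c : ℂ) : HasQExpansion (c • F) where
  mdiff := hF.mdiff.const_smul c
  periodic := hF.periodic.smul c
  bdd := hF.bdd.smul c

lemma normalizedDeriv (hF : HasQExpansion F) : HasQExpansion (D F) :=
  of_hasSum (Derivative.normalizedDerivOfComplex_mdifferentiable hF.mdiff)
    (hasSum_normalizedDerivOfComplex hF.hasSum)

lemma qExpansion_normalizedDeriv (hF : HasQExpansion F) :
    qExpansion 1 (D F) = PowerSeries.theta ℂ (qExpansion 1 F) := by
  ext m
  rw [PowerSeries.coeff_theta]
  exact hF.normalizedDeriv.coeff_unique (hasSum_normalizedDerivOfComplex hF.hasSum) m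

end HasQExpansion

end

/-! ### Ramanujan's differential equations for the Eisenstein series -/

section

open UpperHalfPlane ModularForm Function Filter Complex
open scoped Derivative Manifold Topology Real

/-- A modular form of level one from a slash invariant function with a `q`-expansion. -/
noncomputable def HasQExpansion.toModularForm {F : ℍ → ℂ} (hF : HasQExpansion F) {k : ℤ}
    (h : ∀ γ : SL(2, ℤ), F ∣[k] γ = F) : ModularForm 𝒮ℒ k where
  toFun := F
  slash_action_eq' := fun _ ⟨γ, hγ⟩ ↦ hγ ▸ h γ
  holo' := hF.mdiff
  bdd_at_cusps' {c} hc := by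
    rw [Subgroup.IsArithmetic.isCusp_iff_isCusp_SL2Z] at hc
    rw [OnePoint.isBoundedAt_iff_forall_SL2Z hc]
    intro γ _
    rw [h]
    exact hF.bdd

@[simp] lemma HasQExpansion.coe_toModularForm {F : ℍ → ℂ} (hF : HasQExpansion F) {k : ℤ}
    (h : ∀ γ : SL(2, ℤ), F ∣[k] γ = F) : ⇑(hF.toModularForm h) = F := rfl

/-- In weights less than `12` a modular form of level one is determined by its constant term. -/
lemma ModularForm.qExpansion_eq_of_coeff_zero_eq {k : ℤ} (hk : k < 12) (f g : ModularForm 𝒮ℒ k)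
    (h : (qExpansion 1 f).coeff 0 = (qExpansion 1 g).coeff 0) :
    qExpansion 1 f = qExpansion 1 g := by
  have hsub : qExpansion 1 (f - g : ModularForm 𝒮ℒ k) = qExpansion 1 f - qExpansion 1 g := by
    rw [FunLike.coe_sub]
    exact ModularForm.qExpansion_sub one_pos one_mem_strictPeriods_SL f g
  have h0 : f - g = 0 := by
    refine ModularForm.sturm_bound_levelOne ?_
    rw [show k.toNat / 12 = 0 by omega, hsub]
    refine lt_of_lt_of_le (b := ((1 : ℕ) : ℕ∞)) (by simp) (PowerSeries.nat_le_order _ _ ?_)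
    intro i hi
    obtain rfl : i = 0 := by omega
    rw [map_sub, h, sub_self]
  rw [sub_eq_zero.mp h0]

lemma hasSum_qParam_E2 (τ : ℍ) :
    HasSum (fun m : ℕ ↦ (if m = 0 then 1 else -24 * (ArithmeticFunction.sigma 1 m : ℂ)) •
      Periodic.qParam 1 τ ^ m) (EisensteinSeries.E2 τ) := by
  have h : Periodic.qParam 1 τ = cexp (2 * π * Complex.I * τ) := by simp [Periodic.qParam]
  rw [h]
  exact EisensteinSeries.hasSum_qExpansion_E2 τ

lemma hasQExpansion_E2 : HasQExpansion EisensteinSeries.E2 :=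
  .of_hasSum E2_mdifferentiable hasSum_qParam_E2

lemma qExpansion_E2_coeff (m : ℕ) : (qExpansion 1 EisensteinSeries.E2).coeff m =
    if m = 0 then 1 else -24 * (ArithmeticFunction.sigma 1 m : ℂ) :=
  hasQExpansion_E2.coeff_unique hasSum_qParam_E2 m

namespace HasQExpansion

variable {F G : ℍ → ℂ}

lemma qExpansion_mul (hF : HasQExpansion F) (hG : HasQExpansion G) :
    qExpansion 1 (F * G) = qExpansion 1 F * qExpansion 1 G :=
  UpperHalfPlane.qExpansion_mul hF.analyticAt hG.analyticAt

lemma qExpansion_sub (hF : HasQExpansion F) (hG : HasQExpansion G) :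
    qExpansion 1 (F - G) = qExpansion 1 F - qExpansion 1 G :=
  UpperHalfPlane.qExpansion_sub hF.analyticAt hG.analyticAt

lemma qExpansion_smul (hF : HasQExpansion F) (c : ℂ) :
    qExpansion 1 (c • F) = c • qExpansion 1 F :=
  UpperHalfPlane.qExpansion_smul hF.analyticAt c

lemma serreDerivative_eq (k : ℂ) :
    Derivative.serreDerivative k F = D F - (k * 12⁻¹) • (EisensteinSeries.E2 * F) := by
  ext z; simp [Derivative.serreDerivative_apply, mul_assoc]

lemma serreDerivative (hF : HasQExpansion F) (k : ℂ) :
    HasQExpansion (Derivative.serreDerivative k F) := by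
  rw [serreDerivative_eq]
  exact hF.normalizedDeriv.sub ((hasQExpansion_E2.mul hF).smul _)

lemma qExpansion_serreDerivative (hF : HasQExpansion F) (k : ℂ) :
    qExpansion 1 (Derivative.serreDerivative k F) = PowerSeries.theta ℂ (qExpansion 1 F) -
      (k * 12⁻¹) • (qExpansion 1 EisensteinSeries.E2 * qExpansion 1 F) := by
  rw [serreDerivative_eq, hF.normalizedDeriv.qExpansion_sub ((hasQExpansion_E2.mul hF).smul _),
    (hasQExpansion_E2.mul hF).qExpansion_smul, hasQExpansion_E2.qExpansion_mul hF,
    hF.qExpansion_normalizedDeriv]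

end HasQExpansion

lemma ModularForm.slash_SL_eq {k : ℤ} (f : ModularForm 𝒮ℒ k) (γ : SL(2, ℤ)) : ⇑f ∣[k] γ = ⇑f :=
  f.slash_action_eq' _ ⟨γ, rfl⟩

lemma E₄_coeff_zero : (qExpansion 1 E₄).coeff 0 = 1 :=
  EisensteinSeries.E_qExpansion_coeff_zero _ ⟨2, rfl⟩

lemma E₆_coeff_zero : (qExpansion 1 E₆).coeff 0 = 1 :=
  EisensteinSeries.E_qExpansion_coeff_zero _ ⟨3, rfl⟩

/-- Ramanujan's differential equation for `E₄`: the Serre derivative of `E₄` has weight `6`. -/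
lemma theta_qExpansion_E₄ : 3 * PowerSeries.theta ℂ (qExpansion 1 E₄) =
    qExpansion 1 EisensteinSeries.E2 * qExpansion 1 E₄ - qExpansion 1 E₆ := by
  have hE := HasQExpansion.of_modularForm E₄
  have h := qExpansion_eq_of_coeff_zero_eq (k := 4 + 2) (by norm_num)
    ((hE.serreDerivative ((4 : ℤ) : ℂ)).toModularForm
      fun γ ↦ Derivative.serreDerivative_slash_invariant E₄.holo' (E₄.slash_SL_eq γ))
    (ModularForm.mcast (by norm_num) ((-1 / 3 : ℂ) • E₆)) (by
      rw [HasQExpansion.coe_toModularForm, hE.qExpansion_serreDerivative,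
        ModularForm.qExpansion_mcast, FunLike.coe_smul,
        (HasQExpansion.of_modularForm E₆).qExpansion_smul]
      simp only [map_sub, PowerSeries.coeff_smul, PowerSeries.coeff_theta, PowerSeries.coeff_mul,
        E₆_coeff_zero, E₄_coeff_zero, Finset.Nat.antidiagonal_zero, Finset.sum_singleton,
        qExpansion_E2_coeff]
      norm_num)
  rw [HasQExpansion.coe_toModularForm, hE.qExpansion_serreDerivative,
    ModularForm.qExpansion_mcast, FunLike.coe_smul,
    (HasQExpansion.of_modularForm E₆).qExpansion_smul] at h
  simp only [PowerSeries.smul_eq_C_mul] at h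
  have h3 : (3 : PowerSeries ℂ) = PowerSeries.C 3 := by simp [map_ofNat]
  have e1 : (3 : PowerSeries ℂ) * PowerSeries.C (((4 : ℤ) : ℂ) * 12⁻¹) = 1 := by
    rw [h3, ← map_mul]; norm_num
  have e2 : (3 : PowerSeries ℂ) * PowerSeries.C (-1 / 3 : ℂ) = -1 := by
    rw [h3, ← map_mul]; norm_num
  linear_combination 3 * h + qExpansion 1 EisensteinSeries.E2 * qExpansion 1 E₄ * e1 +
    qExpansion 1 E₆ * e2

/-- Ramanujan's differential equation for `E₆`: the Serre derivative of `E₆` has weight `8`. -/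
lemma theta_qExpansion_E₆ : 2 * PowerSeries.theta ℂ (qExpansion 1 E₆) =
    qExpansion 1 EisensteinSeries.E2 * qExpansion 1 E₆ - qExpansion 1 E₄ ^ 2 := by
  have hE := HasQExpansion.of_modularForm E₆
  have hmul : qExpansion 1 (E₄.mul E₄) = qExpansion 1 E₄ * qExpansion 1 E₄ :=
    ModularForm.qExpansion_mul one_pos one_mem_strictPeriods_SL _ _
  have h := qExpansion_eq_of_coeff_zero_eq (k := 6 + 2) (by norm_num)
    ((hE.serreDerivative ((6 : ℤ) : ℂ)).toModularForm
      fun γ ↦ Derivative.serreDerivative_slash_invariant E₆.holo' (E₆.slash_SL_eq γ))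
    (ModularForm.mcast (by norm_num) ((-1 / 2 : ℂ) • (E₄.mul E₄))) (by
      rw [HasQExpansion.coe_toModularForm, hE.qExpansion_serreDerivative,
        ModularForm.qExpansion_mcast, FunLike.coe_smul,
        (HasQExpansion.of_modularForm (E₄.mul E₄)).qExpansion_smul, hmul]
      simp only [map_sub, PowerSeries.coeff_smul, PowerSeries.coeff_theta, PowerSeries.coeff_mul,
        E₆_coeff_zero, E₄_coeff_zero, Finset.Nat.antidiagonal_zero, Finset.sum_singleton,
        qExpansion_E2_coeff]
      norm_num)
  rw [HasQExpansion.coe_toModularForm, hE.qExpansion_serreDerivative,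
    ModularForm.qExpansion_mcast, FunLike.coe_smul,
    (HasQExpansion.of_modularForm (E₄.mul E₄)).qExpansion_smul, hmul] at h
  simp only [PowerSeries.smul_eq_C_mul] at h
  have h3 : (2 : PowerSeries ℂ) = PowerSeries.C 2 := by simp [map_ofNat]
  have e1 : (2 : PowerSeries ℂ) * PowerSeries.C (((6 : ℤ) : ℂ) * 12⁻¹) = 1 := by
    rw [h3, ← map_mul]; norm_num
  have e2 : (2 : PowerSeries ℂ) * PowerSeries.C (-1 / 2 : ℂ) = -1 := by
    rw [h3, ← map_mul]; norm_num
  linear_combination 2 * h + qExpansion 1 EisensteinSeries.E2 * qExpansion 1 E₆ * e1 +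
    qExpansion 1 E₄ ^ 2 * e2

/-- The derivative of the correction term in the transformation law of `E₂`. -/
lemma normalizedDerivOfComplex_D2 (γ : SL(2, ℤ)) (z : ℍ) :
    D (EisensteinSeries.D2 γ) z = -((γ 1 0 : ℂ) / denom γ z) ^ 2 := by
  have hz : denom γ z ≠ 0 := denom_ne_zero _ _
  have hev : (EisensteinSeries.D2 γ ∘ ofComplex) =ᶠ[𝓝 (z : ℂ)]
      fun w ↦ 2 * π * Complex.I * (γ 1 0 : ℂ) * ((γ 1 0 : ℂ) * w + γ 1 1)⁻¹ := by
    filter_upwards [isOpen_upperHalfPlaneSet.mem_nhds z.im_pos] with w hw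
    have hden := ModularGroup.denom_apply γ ⟨w, hw⟩
    simp only [comp_apply, ofComplex_apply_of_im_pos hw, EisensteinSeries.D2, div_eq_mul_inv]
    rw [hden]
  rw [ModularGroup.denom_apply] at hz ⊢
  have hd : HasDerivAt (fun w : ℂ ↦ (γ 1 0 : ℂ) * w + γ 1 1) (γ 1 0 : ℂ) z := by
    simpa using ((hasDerivAt_id (z : ℂ)).const_mul (γ 1 0 : ℂ)).add_const (γ 1 1 : ℂ)
  have hD : D (EisensteinSeries.D2 γ) z =
      (2 * π * Complex.I)⁻¹ * deriv (EisensteinSeries.D2 γ ∘ ofComplex) z := rfl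
  have hd' := ((hd.fun_inv hz).const_mul (2 * π * Complex.I * (γ 1 0 : ℂ))).deriv
  rw [hD, hev.deriv_eq]
  refine (congrArg _ hd').trans ?_
  have hpi := two_pi_I_ne_zero
  field_simp

/-- The combination `D E₂ - E₂ ^ 2 / 12` is modular of weight `4`: the failure of `E₂` to be modular
cancels against that of `D` to preserve modularity. -/
lemma serreDerivative_one_E2_slash (γ : SL(2, ℤ)) :
    Derivative.serreDerivative 1 EisensteinSeries.E2 ∣[(4 : ℤ)] γ =
      Derivative.serreDerivative 1 EisensteinSeries.E2 := by
  ext z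
  have hκ : (1 / (2 * riemannZeta 2) : ℂ) ≠ 0 := by
    rw [riemannZeta_two]; simp [Real.pi_ne_zero]
  have hD2 : MDiff (EisensteinSeries.D2 γ) := by
    have h : EisensteinSeries.D2 γ = (1 / (2 * riemannZeta 2) : ℂ)⁻¹ •
        (EisensteinSeries.E2 - EisensteinSeries.E2 ∣[(2 : ℤ)] γ) := by
      rw [EisensteinSeries.E2_slash_action, sub_sub_cancel, inv_smul_smul₀ hκ]
    rw [h]
    exact (E2_mdifferentiable.sub (E2_mdifferentiable.slash _ _)).const_smul _
  have h1 := congrFun (Derivative.normalizedDerivOfComplex_SL_slash (k := 2) E2_mdifferentiable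
    (γ := γ)) z
  rw [EisensteinSeries.E2_slash_action, Derivative.normalizedDerivOfComplex_sub _ _
    E2_mdifferentiable (hD2.const_smul _), Derivative.normalizedDerivOfComplex_smul _ _ hD2] at h1
  have h2 : (Derivative.serreDerivative 1 EisensteinSeries.E2 ∣[(4 : ℤ)] γ) z =
      (D EisensteinSeries.E2 ∣[(2 + 2 : ℤ)] γ) z -
        12⁻¹ * ((EisensteinSeries.E2 ∣[(2 : ℤ)] γ) z * (EisensteinSeries.E2 ∣[(2 : ℤ)] γ) z) := by
    have := congrFun (ModularForm.mul_slash_SL2 2 2 γ EisensteinSeries.E2 EisensteinSeries.E2) z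
    rw [Pi.mul_apply] at this
    rw [← this]
    simp only [ModularForm.SL_slash_apply, Derivative.serreDerivative_apply, Pi.mul_apply]
    norm_num
    ring
  rw [h2, EisensteinSeries.E2_slash_action]
  simp only [Pi.sub_apply, Pi.smul_apply, smul_eq_mul, normalizedDerivOfComplex_D2,
    EisensteinSeries.D2, riemannZeta_two, Derivative.serreDerivative_apply] at h1 ⊢
  set u : ℂ := (γ 1 0 : ℂ) / denom γ z with hu
  have hu2 : 2 * π * Complex.I * (γ 1 0 : ℂ) / denom γ z = 2 * π * Complex.I * u := by
    rw [hu, mul_div_assoc]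
  rw [hu2] at h1 ⊢
  have hpi : (π : ℂ) ≠ 0 := by exact_mod_cast Real.pi_ne_zero
  have hI := Complex.I_sq
  have e1 : (1 / (2 * ((π : ℂ) ^ 2 / 6))) * (2 * π * Complex.I * u) =
      6 * (π : ℂ)⁻¹ * Complex.I * u := by
    field_simp
  have e2 : (2 * (π : ℂ) * Complex.I)⁻¹ = -Complex.I * (π : ℂ)⁻¹ / 2 := by
    rw [mul_inv, mul_inv, Complex.inv_I]; ring
  have e3 : (1 / (2 * ((π : ℂ) ^ 2 / 6))) = 3 * (π : ℂ)⁻¹ ^ 2 := by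
    field_simp
    norm_num
  rw [e1, e2, e3] at h1
  rw [e1]
  simp only [Int.cast_ofNat] at h1
  linear_combination -h1 + 3 * (π : ℂ)⁻¹ ^ 2 * u ^ 2 * hI

/-- Ramanujan's differential equation for `E₂`. -/
lemma theta_qExpansion_E2 : 12 * PowerSeries.theta ℂ (qExpansion 1 EisensteinSeries.E2) =
    qExpansion 1 EisensteinSeries.E2 ^ 2 - qExpansion 1 E₄ := by
  have hE := hasQExpansion_E2
  have h := qExpansion_eq_of_coeff_zero_eq (k := 4) (by norm_num)
    ((hE.serreDerivative 1).toModularForm serreDerivative_one_E2_slash) ((-1 / 12 : ℂ) • E₄) (by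
      rw [HasQExpansion.coe_toModularForm, hE.qExpansion_serreDerivative, FunLike.coe_smul,
        (HasQExpansion.of_modularForm E₄).qExpansion_smul]
      simp only [map_sub, PowerSeries.coeff_smul, PowerSeries.coeff_theta, PowerSeries.coeff_mul,
        E₄_coeff_zero, Finset.Nat.antidiagonal_zero, Finset.sum_singleton, qExpansion_E2_coeff]
      norm_num)
  rw [HasQExpansion.coe_toModularForm, hE.qExpansion_serreDerivative, FunLike.coe_smul,
    (HasQExpansion.of_modularForm E₄).qExpansion_smul] at h
  simp only [PowerSeries.smul_eq_C_mul] at h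
  have h3 : (12 : PowerSeries ℂ) = PowerSeries.C 12 := by simp [map_ofNat]
  have e1 : (12 : PowerSeries ℂ) * PowerSeries.C (1 * 12⁻¹ : ℂ) = 1 := by
    rw [h3, ← map_mul]; norm_num
  have e2 : (12 : PowerSeries ℂ) * PowerSeries.C (-1 / 12 : ℂ) = -1 := by
    rw [h3, ← map_mul]; norm_num
  linear_combination 12 * h + qExpansion 1 EisensteinSeries.E2 ^ 2 * e1 + qExpansion 1 E₄ * e2

end

/-! ### Integral `q`-expansions of the Eisenstein series and of the discriminant -/

section

open UpperHalfPlane ModularForm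

namespace IntegralEisenstein

/-- The series `∑ σ_k(n) q ^ n`. -/
def sigmaSeries (k : ℕ) : PowerSeries ℤ :=
  PowerSeries.mk fun n ↦ (ArithmeticFunction.sigma k n : ℤ)

lemma coeff_one_add_C_mul_sigmaSeries (c : ℤ) (k n : ℕ) :
    (1 + PowerSeries.C c * sigmaSeries k).coeff n =
      if n = 0 then 1 else c * (ArithmeticFunction.sigma k n : ℤ) := by
  rw [map_add, PowerSeries.coeff_C_mul, PowerSeries.coeff_one, sigmaSeries, PowerSeries.coeff_mk]
  rcases eq_or_ne n 0 with rfl | hn <;> simp [*]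

lemma map_one_add_C_mul_sigmaSeries (c : ℤ) (k n : ℕ) :
    ((1 + PowerSeries.C c * sigmaSeries k).map (Int.castRingHom ℂ)).coeff n =
      if n = 0 then 1 else (c : ℂ) * (ArithmeticFunction.sigma k n : ℂ) := by
  rw [PowerSeries.coeff_map, coeff_one_add_C_mul_sigmaSeries]
  split_ifs <;> simp

lemma map_E2 : (1 + PowerSeries.C (-24) * sigmaSeries 1).map (Int.castRingHom ℂ) =
    qExpansion 1 EisensteinSeries.E2 := by
  ext n
  rw [map_one_add_C_mul_sigmaSeries, qExpansion_E2_coeff]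
  norm_num

lemma map_E₄ : (1 + PowerSeries.C 240 * sigmaSeries 3).map (Int.castRingHom ℂ) =
    qExpansion 1 E₄ := by
  ext n
  rw [map_one_add_C_mul_sigmaSeries, EisensteinSeries.E_qExpansion_coeff _ ⟨2, rfl⟩,
    show bernoulli 4 = -1 / 30 by decide +kernel]
  norm_num

lemma map_E₆ : (1 + PowerSeries.C (-504) * sigmaSeries 5).map (Int.castRingHom ℂ) =
    qExpansion 1 E₆ := by
  ext n
  rw [map_one_add_C_mul_sigmaSeries, EisensteinSeries.E_qExpansion_coeff _ ⟨3, rfl⟩,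
    show bernoulli 6 = 1 / 42 by decide +kernel]
  norm_num

lemma map_castRingHom_injective :
    Function.Injective (PowerSeries.map (Int.castRingHom ℂ)) :=
  PowerSeries.map_injective _ Int.cast_injective

lemma coeff_one_pow_three_sub_pow_two {A B : PowerSeries ℤ} (hA : A.constantCoeff = 1)
    (hB : B.constantCoeff = 1) :
    (A ^ 3 - B ^ 2).coeff 1 = 3 * A.coeff 1 - 2 * B.coeff 1 := by
  simp [pow_succ, PowerSeries.coeff_one_mul, hA, hB]
  ring

/-- The integral `q`-expansions of `E₂`, `E₄` and `E₆`. -/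
noncomputable def triple : RamanujanTriple ℤ where
  P := 1 + PowerSeries.C (-24) * sigmaSeries 1
  Q := 1 + PowerSeries.C 240 * sigmaSeries 3
  R := 1 + PowerSeries.C (-504) * sigmaSeries 5
  constantCoeff_P := by simp [sigmaSeries]
  constantCoeff_Q := by simp [sigmaSeries]
  constantCoeff_R := by simp [sigmaSeries]
  theta_P := map_castRingHom_injective <| by
    simp only [map_mul, map_sub, map_pow, PowerSeries.map_theta, map_E2, map_E₄,
      map_ofNat (PowerSeries.map (Int.castRingHom ℂ)) 12]
    exact theta_qExpansion_E2
  theta_Q := map_castRingHom_injective <| by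
    simp only [map_mul, map_sub, PowerSeries.map_theta, map_E2, map_E₄, map_E₆,
      map_ofNat (PowerSeries.map (Int.castRingHom ℂ)) 3]
    exact theta_qExpansion_E₄
  theta_R := map_castRingHom_injective <| by
    simp only [map_mul, map_sub, map_pow, PowerSeries.map_theta, map_E2, map_E₄, map_E₆,
      map_ofNat (PowerSeries.map (Int.castRingHom ℂ)) 2]
    exact theta_qExpansion_E₆
  coeff_one := by
    rw [coeff_one_pow_three_sub_pow_two, coeff_one_add_C_mul_sigmaSeries,
      coeff_one_add_C_mul_sigmaSeries]
    · simp
    · simp [sigmaSeries]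
    · simp [sigmaSeries]

lemma map_triple_Q : triple.Q.map (Int.castRingHom ℂ) = qExpansion 1 E₄ := map_E₄

lemma map_triple_R : triple.R.map (Int.castRingHom ℂ) = qExpansion 1 E₆ := map_E₆

lemma twelve_dvd (d : ℤ) : 12 ∣ 5 * d ^ 3 + 7 * d ^ 5 := by
  have h : ∀ x : ZMod 12, 5 * x ^ 3 + 7 * x ^ 5 = 0 := by decide
  refine (ZMod.intCast_zmod_eq_zero_iff_dvd _ 12).mp ?_
  push_cast
  exact h d

/-- The `q`-expansion of the discriminant is integral: with `E₄ = 1 + 240 A` and `E₆ = 1 - 504 B`,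
the difference `E₄ ^ 3 - E₆ ^ 2` is `144 (5 A + 7 B)` modulo `1728`. -/
lemma exists_delta : ∃ F : PowerSeries ℤ, 1728 * F = triple.Q ^ 3 - triple.R ^ 2 := by
  obtain ⟨D, hD⟩ : ∃ D : PowerSeries ℤ, 12 * D = 5 * sigmaSeries 3 + 7 * sigmaSeries 5 := by
    have h : ∀ n, ∃ c : ℤ, 12 * c = 5 * (sigmaSeries 3).coeff n + 7 * (sigmaSeries 5).coeff n := by
      intro n
      obtain ⟨c, hc⟩ : (12 : ℤ) ∣ 5 * (sigmaSeries 3).coeff n + 7 * (sigmaSeries 5).coeff n := by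
        simp only [sigmaSeries, PowerSeries.coeff_mk, ArithmeticFunction.sigma_apply, Nat.cast_sum,
          Nat.cast_pow, Finset.mul_sum, ← Finset.sum_add_distrib]
        exact Finset.dvd_sum fun d _ ↦ twelve_dvd d
      exact ⟨c, hc.symm⟩
    choose c hc using h
    refine ⟨PowerSeries.mk c, ?_⟩
    ext n
    have h12 : (12 : PowerSeries ℤ) = PowerSeries.C 12 := by simp [map_ofNat]
    have h5 : (5 : PowerSeries ℤ) = PowerSeries.C 5 := by simp [map_ofNat]
    have h7 : (7 : PowerSeries ℤ) = PowerSeries.C 7 := by simp [map_ofNat]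
    rw [h12, h5, h7, map_add, PowerSeries.coeff_C_mul, PowerSeries.coeff_C_mul,
      PowerSeries.coeff_C_mul, PowerSeries.coeff_mk, hc]
  refine ⟨D + 100 * sigmaSeries 3 ^ 2 + 8000 * sigmaSeries 3 ^ 3 - 147 * sigmaSeries 5 ^ 2, ?_⟩
  have hQ : triple.Q = 1 + 240 * sigmaSeries 3 := by simp [triple, map_ofNat]
  have hR : triple.R = 1 - 504 * sigmaSeries 5 := by
    simp [triple, map_ofNat, sub_eq_add_neg]
  rw [hQ, hR]
  linear_combination 144 * hD

/-- The integral `q`-expansion of the discriminant. -/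
noncomputable def delta : PowerSeries ℤ := exists_delta.choose

lemma delta_spec : 1728 * delta = triple.Q ^ 3 - triple.R ^ 2 := exists_delta.choose_spec

lemma map_delta : delta.map (Int.castRingHom ℂ) = qExpansion 1 CuspForm.discriminant := by
  have h : (1728 : ℂ) • (⇑CuspForm.discriminant : ℍ → ℂ) = E₄ * (E₄ * E₄) - E₆ * E₆ := by
    ext z
    simp only [CuspForm.coe_discriminant, Pi.smul_apply, Pi.sub_apply, Pi.mul_apply, smul_eq_mul,
      discriminant_eq_E₄_cube_sub_E₆_sq]
    ring
  have h4 := HasQExpansion.of_modularForm E₄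
  have h6 := HasQExpansion.of_modularForm E₆
  have hΔ := HasQExpansion.of_modularForm (CuspForm.toModularFormₗ CuspForm.discriminant)
  have h' := congrArg (qExpansion 1) h
  rw [(h4.mul (h4.mul h4)).qExpansion_sub (h6.mul h6), h4.qExpansion_mul (h4.mul h4),
    h4.qExpansion_mul h4, h6.qExpansion_mul h6,
    show (⇑CuspForm.discriminant : ℍ → ℂ) = CuspForm.toModularFormₗ CuspForm.discriminant from rfl,
    hΔ.qExpansion_smul, PowerSeries.smul_eq_C_mul, map_ofNat] at h'
  have h'' := congrArg (PowerSeries.map (Int.castRingHom ℂ)) delta_spec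
  rw [map_mul, map_sub, map_pow, map_pow, map_triple_Q, map_triple_R, map_ofNat] at h''
  refine mul_left_cancel₀ (a := (1728 : PowerSeries ℂ)) ?_ ?_
  · have : (1728 : PowerSeries ℂ) = PowerSeries.C 1728 := by simp [map_ofNat]
    rw [this, Ne, map_eq_zero_iff _ PowerSeries.C_injective]
    norm_num
  · refine h''.trans (Eq.trans ?_ h'.symm)
    ring

/-- The discriminant is `q` times a unit of `ℤ⟦q⟧`. -/
lemma exists_delta_eq : ∃ U : (PowerSeries ℤ)ˣ, delta = PowerSeries.X * (U : PowerSeries ℤ) := by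
  have h1728 : (1728 : PowerSeries ℤ) = PowerSeries.C 1728 := by simp [map_ofNat]
  have h0 : PowerSeries.constantCoeff delta = 0 := by
    have := congrArg PowerSeries.constantCoeff delta_spec
    rw [map_sub, map_pow, map_pow, triple.constantCoeff_Q, triple.constantCoeff_R, map_mul, h1728,
      PowerSeries.constantCoeff_C] at this
    omega
  obtain ⟨U, hU⟩ := PowerSeries.X_dvd_iff.mpr h0
  have h1 : PowerSeries.constantCoeff U = 1 := by
    have := congrArg (PowerSeries.coeff 1) delta_spec
    rw [triple.coeff_one, h1728, PowerSeries.coeff_C_mul, hU,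
      ← zero_add 1, PowerSeries.coeff_succ_X_mul,
      PowerSeries.coeff_zero_eq_constantCoeff_apply] at this
    omega
  exact ⟨(PowerSeries.isUnit_iff_constantCoeff.mpr (h1 ▸ isUnit_one)).unit, hU⟩

end IntegralEisenstein

end

/-! ### Integral modular forms and their reductions -/

section

open UpperHalfPlane ModularForm

namespace IntegralEisenstein

/-- `F` is an integral `q`-expansion of the modular form `f`. -/
def IsQExpansion {k : ℤ} (f : ModularForm 𝒮ℒ k) (F : PowerSeries ℤ) : Prop :=
  qExpansion 1 f = F.map (Int.castRingHom ℂ)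

namespace IsQExpansion

variable {k : ℤ} {f g : ModularForm 𝒮ℒ k} {F G : PowerSeries ℤ}

lemma coeff (hf : IsQExpansion f F) (n : ℕ) : (qExpansion 1 f).coeff n = (F.coeff n : ℂ) := by
  rw [hf, PowerSeries.coeff_map]; rfl

lemma sub (hf : IsQExpansion f F) (hg : IsQExpansion g G) : IsQExpansion (f - g) (F - G) := by
  rw [IsQExpansion, FunLike.coe_sub, ModularForm.qExpansion_sub one_pos one_mem_strictPeriods_SL,
    hf, hg, map_sub]

lemma add (hf : IsQExpansion f F) (hg : IsQExpansion g G) : IsQExpansion (f + g) (F + G) := by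
  rw [IsQExpansion, FunLike.coe_add, ModularForm.qExpansion_add one_pos one_mem_strictPeriods_SL,
    hf, hg, map_add]

lemma smul (hf : IsQExpansion f F) (c : ℤ) :
    IsQExpansion ((c : ℂ) • f) (PowerSeries.C c * F) := by
  rw [IsQExpansion, FunLike.coe_smul, (HasQExpansion.of_modularForm f).qExpansion_smul, hf,
    map_mul, PowerSeries.map_C, PowerSeries.smul_eq_C_mul]
  rfl

lemma eq_zero_of_eq_zero (hf : IsQExpansion f F) (h : f = 0) : F = 0 := by
  apply map_castRingHom_injective
  rw [map_zero, ← hf, h, FunLike.coe_zero, UpperHalfPlane.qExpansion_zero]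

end IsQExpansion

/-- The modular form `E₄ ^ a E₆ ^ b`. -/
noncomputable def eisensteinMonomial {k : ℤ} (a b : ℕ) (h : 4 * a + 6 * b = k) :
    ModularForm 𝒮ℒ k :=
  ((E₄.pow a).mul (E₆.pow b)).mcast (by rw [← h]; ring)

lemma isQExpansion_eisensteinMonomial {k : ℤ} (a b : ℕ) (h : 4 * a + 6 * b = k) :
    IsQExpansion (eisensteinMonomial a b h) (triple.Q ^ a * triple.R ^ b) := by
  rw [IsQExpansion, eisensteinMonomial, ModularForm.qExpansion_mcast,
    ModularForm.qExpansion_mul one_pos one_mem_strictPeriods_SL,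
    ModularForm.qExpansion_pow one_pos one_mem_strictPeriods_SL,
    ModularForm.qExpansion_pow one_pos one_mem_strictPeriods_SL, map_mul, map_pow, map_pow,
    map_triple_Q, map_triple_R]

lemma constantCoeff_Q_pow_mul_R_pow (a b : ℕ) :
    (triple.Q ^ a * triple.R ^ b).coeff 0 = 1 := by
  rw [PowerSeries.coeff_zero_eq_constantCoeff_apply, map_mul, map_pow, map_pow,
    triple.constantCoeff_Q, triple.constantCoeff_R, one_pow, one_pow, one_mul]

/-- An integral form with vanishing constant term is the discriminant times an integral form. -/
lemma IsQExpansion.exists_eq_delta_mul {k : ℤ} {f : ModularForm 𝒮ℒ k} {F : PowerSeries ℤ}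
    (hf : IsQExpansion f F) (h0 : F.coeff 0 = 0) :
    ∃ (g : ModularForm 𝒮ℒ (k - 12)) (G : PowerSeries ℤ), IsQExpansion g G ∧ F = delta * G := by
  have hf0 : (qExpansion 1 f).coeff 0 = 0 := by rw [hf.coeff, h0, Int.cast_zero]
  obtain ⟨U, hU⟩ := exists_delta_eq
  obtain ⟨F', rfl⟩ := PowerSeries.X_dvd_iff.mpr
    ((PowerSeries.coeff_zero_eq_constantCoeff_apply F).symm.trans h0)
  have hF : PowerSeries.X * F' = delta * (F' * (↑U⁻¹ : PowerSeries ℤ)) := by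
    rw [hU, mul_comm F', ← mul_assoc, mul_assoc _ (U : PowerSeries ℤ), Units.mul_inv, mul_one]
  refine ⟨CuspForm.discriminantEquiv (toCuspForm f hf0), F' * (↑U⁻¹ : PowerSeries ℤ), ?_, hF⟩
  have h := qExpansion_eq_qExpansion_discriminant_mul f hf0
  rw [hf, hF, map_mul] at h
  have hd : delta.map (Int.castRingHom ℂ) = qExpansion 1 ModularForm.discriminant := map_delta
  rw [hd] at h
  refine (mul_left_cancel₀ (fun h0 ↦ ?_) h).symm
  have := discriminant_qExpansion_coeff_one
  rw [h0, map_zero] at this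
  exact zero_ne_one this

lemma exists_four_mul_add_six_mul (k : ℕ) (hk : Even k) (hk2 : k ≠ 2) :
    ∃ a b : ℕ, 4 * a + 6 * b = k := by
  obtain ⟨m, rfl⟩ := hk
  rcases Nat.even_or_odd m with ⟨n, rfl⟩ | ⟨n, rfl⟩
  · exact ⟨n, 0, by omega⟩
  · exact ⟨n - 1, 1, by omega⟩

/-- The reduction of an integral modular form is a polynomial in the reductions of `E₄` and `E₆`:
subtract a multiple of a monomial `E₄ ^ a E₆ ^ b`, divide by the discriminant, and proceed by
induction on the weight. -/
lemma IsQExpansion.exists_eval_eq {K : Type*} [Field K] (hK : (1728 : K) ≠ 0) (k : ℕ)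
    (f : ModularForm 𝒮ℒ k) (F : PowerSeries ℤ) (hf : IsQExpansion f F) :
    ∃ φ : MvPolynomial (Fin 2) K, MvPolynomial.IsWeightedHomogeneous eisensteinWeight φ k ∧
      (triple.map (Int.castRingHom K)).eval φ = F.map (Int.castRingHom K) := by
  induction k using Nat.strong_induction_on generalizing F with | _ k ih =>
  by_cases hz : f = 0
  · exact ⟨0, MvPolynomial.isWeightedHomogeneous_zero _ _ _, by
      rw [hf.eq_zero_of_eq_zero hz, map_zero, map_zero]⟩
  have heven : Even k := by
    by_contra h
    exact hz (ModularForm.levelOne_odd_weight_eq_zero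
      (by exact_mod_cast Nat.not_even_iff_odd.mp h) f)
  have hk2 : k ≠ 2 := by
    rintro rfl
    exact hz (rank_zero_iff_forall_zero.mp levelOne_weight_two_rank_zero f)
  obtain ⟨a, b, hab⟩ := exists_four_mul_add_six_mul k heven hk2
  have hab' : 4 * (a : ℤ) + 6 * b = k := by exact_mod_cast hab
  have hM := isQExpansion_eisensteinMonomial a b hab'
  obtain ⟨g, G, hg, hG⟩ := (hf.sub (hM.smul (F.coeff 0))).exists_eq_delta_mul (by
    rw [map_sub, PowerSeries.coeff_C_mul, constantCoeff_Q_pow_mul_R_pow, mul_one, sub_self])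
  have hmon : MvPolynomial.IsWeightedHomogeneous eisensteinWeight
      (MvPolynomial.C ((F.coeff 0 : ℤ) : K) * (MvPolynomial.X 0 ^ a * MvPolynomial.X 1 ^ b)) k := by
    simpa [hab] using (MvPolynomial.isWeightedHomogeneous_C eisensteinWeight
      ((F.coeff 0 : ℤ) : K)).mul (MvPolynomial.isWeightedHomogeneous_X_pow_mul_X_pow a b)
  have hev : (triple.map (Int.castRingHom K)).eval
      (MvPolynomial.C ((F.coeff 0 : ℤ) : K) * (MvPolynomial.X 0 ^ a * MvPolynomial.X 1 ^ b)) =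
      (PowerSeries.C (F.coeff 0) * (triple.Q ^ a * triple.R ^ b)).map (Int.castRingHom K) := by
    simp [RamanujanTriple.eval, RamanujanTriple.map]
  rcases lt_or_ge k 12 with hk | hk
  · have hg0 : g = 0 := rank_zero_iff_forall_zero.mp
      (levelOne_neg_weight_rank_zero (by omega)) g
    refine ⟨_, hmon, hev.trans (congrArg _ ?_)⟩
    rw [hg.eq_zero_of_eq_zero hg0, mul_zero, sub_eq_zero] at hG
    exact hG.symm
  · have hk12 : ((k : ℤ) - 12) = ((k - 12 : ℕ) : ℤ) := by omega
    obtain ⟨ψ, hψ, hψG⟩ := ih (k - 12) (by omega) (g.mcast hk12) G hg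
    have hΔ : MvPolynomial.IsWeightedHomogeneous eisensteinWeight
        (MvPolynomial.C (1728 : K)⁻¹ * (MvPolynomial.X 0 ^ 3 - MvPolynomial.X 1 ^ 2)) 12 := by
      simpa using (MvPolynomial.isWeightedHomogeneous_C eisensteinWeight (1728 : K)⁻¹).mul
        ((MvPolynomial.isWeightedHomogeneous_X_zero.pow 3).sub
          (MvPolynomial.isWeightedHomogeneous_X_one.pow 2))
    have hevΔ : (triple.map (Int.castRingHom K)).eval
        (MvPolynomial.C (1728 : K)⁻¹ * (MvPolynomial.X 0 ^ 3 - MvPolynomial.X 1 ^ 2)) =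
        delta.map (Int.castRingHom K) := by
      have hd := congrArg (PowerSeries.map (Int.castRingHom K)) delta_spec
      have h1 : (1728 : PowerSeries K) = PowerSeries.C 1728 := by simp [map_ofNat]
      rw [map_mul, map_ofNat, h1] at hd
      have : (triple.map (Int.castRingHom K)).eval
        (MvPolynomial.C (1728 : K)⁻¹ * (MvPolynomial.X 0 ^ 3 - MvPolynomial.X 1 ^ 2)) =
          PowerSeries.C (1728 : K)⁻¹ * (triple.Q ^ 3 - triple.R ^ 2).map (Int.castRingHom K) := by
        simp [RamanujanTriple.eval, RamanujanTriple.map]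
      rw [this, ← hd, ← mul_assoc, ← map_mul, inv_mul_cancel₀ hK, map_one, one_mul]
    refine ⟨_, hmon.add (by simpa [show 12 + (k - 12) = k by omega] using hΔ.mul hψ), ?_⟩
    rw [map_add, map_mul _ (_ * _) ψ, hev, hevΔ, hψG, ← map_mul, ← map_add]
    exact congrArg _ (by rw [← hG]; ring)


/-- Integral forms with prescribed coefficients up to the Sturm bound. -/
lemma exists_isQExpansion_coeff_eq (k : ℕ) (hk : Even k) (hk2 : k % 12 ≠ 2) (V : PowerSeries ℤ) :
    ∃ (f : ModularForm 𝒮ℒ k) (F : PowerSeries ℤ), IsQExpansion f F ∧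
      ∀ i ≤ k / 12, F.coeff i = V.coeff i := by
  induction k using Nat.strong_induction_on generalizing V with | _ k ih =>
  obtain ⟨a, b, hab⟩ := exists_four_mul_add_six_mul k hk (by omega)
  have hM := (isQExpansion_eisensteinMonomial (k := k) a b (by exact_mod_cast hab)).smul (V.coeff 0)
  have hM0 : (PowerSeries.C (V.coeff 0) * (triple.Q ^ a * triple.R ^ b)).coeff 0 = V.coeff 0 := by
    rw [PowerSeries.coeff_C_mul, constantCoeff_Q_pow_mul_R_pow, mul_one]
  set M := PowerSeries.C (V.coeff 0) * (triple.Q ^ a * triple.R ^ b)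
  rcases lt_or_ge k 12 with hk12 | hk12
  · refine ⟨_, _, hM, fun i hi ↦ ?_⟩
    obtain rfl : i = 0 := by omega
    exact hM0
  obtain ⟨U, hU⟩ := exists_delta_eq
  -- It remains to approximate `V - M = q W` by `Δ g = q U g`, that is, `g` by `U⁻¹ W`.
  obtain ⟨W, hW⟩ := PowerSeries.X_dvd_iff.mpr
    ((PowerSeries.coeff_zero_eq_constantCoeff_apply (V - M)).symm.trans
      (by rw [map_sub, hM0, sub_self]))
  have hk' : Even (k - 12) := by
    obtain ⟨m, rfl⟩ := hk
    exact ⟨m - 6, by omega⟩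
  obtain ⟨g, G, hg, hG⟩ := ih (k - 12) (by omega) hk' (by omega) (↑U⁻¹ * W)
  have hΔg : IsQExpansion (k := k)
      (((CuspForm.toModularFormₗ CuspForm.discriminant).mul g).mcast (by omega)) (delta * G) := by
    rw [IsQExpansion, ModularForm.qExpansion_mcast,
      ModularForm.qExpansion_mul one_pos one_mem_strictPeriods_SL, hg, map_mul, map_delta]
    rfl
  refine ⟨_, _, hM.add hΔg, fun i hi ↦ ?_⟩
  rw [eq_add_of_sub_eq' hW, map_add, map_add, hU, mul_assoc]
  congr 1
  rcases i with _ | i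
  · simp
  · rw [PowerSeries.coeff_succ_X_mul, PowerSeries.coeff_succ_X_mul,
      show W = U * (↑U⁻¹ * W) by rw [← mul_assoc, Units.mul_inv, one_mul],
      PowerSeries.coeff_mul, PowerSeries.coeff_mul]
    refine Finset.sum_congr rfl fun x hx ↦ ?_
    have := Finset.HasAntidiagonal.mem_antidiagonal.mp hx
    rw [hG _ (by omega)]

end IntegralEisenstein

/-- By the theorem of von Staudt and Clausen, `p` divides the denominator of `B_{p-1}`. -/
lemma bernoulli_den_dvd {p : ℕ} (hp : p.Prime) (h2 : p ≠ 2) : p ∣ (bernoulli (p - 1)).den := by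
  obtain ⟨k, hk⟩ := hp.even_sub_one h2
  rw [← two_mul] at hk
  obtain ⟨z, hz⟩ := Bernoulli.vonStaudt_clausen k
  set s := {q ∈ Finset.range (2 * k + 2) | q.Prime ∧ q - 1 ∣ 2 * k} with hs
  have hps : p ∈ s := by
    have := hp.two_le
    simp only [hs, Finset.mem_filter, Finset.mem_range, ← hk]
    exact ⟨by omega, hp, dvd_rfl⟩
  rw [← Finset.add_sum_erase _ _ hps, ← hk] at hz
  -- Multiplication by `N`, which is prime to `p`, clears all denominators but `p` in the sum.
  set N := ∏ q ∈ s.erase p, q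
  have hN : ¬ p ∣ N := by
    rw [hp.prime.dvd_finsetProd_iff]
    rintro ⟨q, hq, hpq⟩
    simp only [hs, Finset.mem_erase, Finset.mem_filter] at hq
    exact hq.1 ((Nat.prime_dvd_prime_iff_eq hp hq.2.2.1).mp hpq).symm
  have hsum : ∃ t : ℤ, (N : ℚ) * ∑ q ∈ s.erase p, (1 : ℚ) / q = t := by
    rw [Finset.mul_sum]
    refine Finset.sum_induction _ (fun x : ℚ ↦ ∃ t : ℤ, x = t) ?_ ⟨0, by simp⟩ fun q hq ↦ ?_
    · rintro _ _ ⟨a, rfl⟩ ⟨b, rfl⟩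
      exact ⟨a + b, by push_cast; rfl⟩
    · obtain ⟨c, hc⟩ := Finset.dvd_prod_of_mem (fun q ↦ q) hq
      have hq0 : (q : ℚ) ≠ 0 := by
        simp only [hs, Finset.mem_erase, Finset.mem_filter] at hq
        exact_mod_cast hq.2.2.1.ne_zero
      refine ⟨c, ?_⟩
      have : (N : ℚ) = q * c := by exact_mod_cast hc
      rw [this]
      field_simp
      simp
  obtain ⟨t, ht⟩ := hsum
  set B := bernoulli (p - 1)
  have hB : B * B.den = B.num := Rat.mul_den_eq_num B
  have hp0 : (p : ℚ) ≠ 0 := by exact_mod_cast hp.ne_zero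
  have key : ((N * B.den : ℤ) : ℚ) =
      ((p * (B.den * N * z - B.den * t - N * B.num) : ℤ) : ℚ) := by
    push_cast
    rw [← hB, hz, ← ht]
    field_simp
    ring
  have key' : (p : ℤ) ∣ ((N * B.den : ℕ) : ℤ) := ⟨_, by exact_mod_cast key⟩
  exact (hp.dvd_mul.mp (Int.natCast_dvd_natCast.mp key')).resolve_left hN

namespace IntegralEisenstein

/-- The Hasse invariant: modulo `p` the Eisenstein series of weight `p - 1` reduces to `1`. -/
lemma exists_eval_eq_one {p : ℕ} [Fact p.Prime] (hp : 3 < p) :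
    ∃ A : MvPolynomial (Fin 2) (ZMod p),
      MvPolynomial.IsWeightedHomogeneous eisensteinWeight A (p - 1) ∧
      (triple.map (Int.castRingHom (ZMod p))).eval A = 1 := by
  have hpp : p.Prime := Fact.out
  have heven := hpp.even_sub_one (by omega)
  have hden := bernoulli_den_dvd hpp (by omega)
  set B := bernoulli (p - 1) with hB
  have hnum : ((B.num : ℤ) : ZMod p) ≠ 0 := by
    rw [Ne, ZMod.intCast_zmod_eq_zero_iff_dvd]
    intro h
    have h1 := Nat.dvd_gcd (Int.natCast_dvd.mp h) hden
    rw [B.reduced] at h1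
    exact hpp.one_lt.ne' (Nat.dvd_one.mp h1)
  have hB0 : (B : ℂ) ≠ 0 := by
    rw [Ne, Rat.cast_eq_zero]
    intro h
    rw [h] at hnum
    simp at hnum
  -- The multiple `N E_{p-1}` by the numerator `N` of `B_{p-1}` is integral, and its higher
  -- coefficients are multiples of the denominator, hence of `p`.
  have hE : IsQExpansion ((B.num : ℂ) • ModularForm.E (k := p - 1) (by omega))
      (PowerSeries.C B.num +
        PowerSeries.C (-(2 * ((p - 1 : ℕ) : ℤ) * B.den)) * sigmaSeries (p - 1 - 1)) := by
    rw [IsQExpansion, FunLike.coe_smul, (HasQExpansion.of_modularForm _).qExpansion_smul]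
    ext n
    rw [PowerSeries.coeff_smul, EisensteinSeries.E_qExpansion_coeff _ heven, PowerSeries.coeff_map,
      map_add, PowerSeries.coeff_C_mul, sigmaSeries, PowerSeries.coeff_mk, PowerSeries.coeff_C]
    rcases eq_or_ne n 0 with rfl | hn
    · simp
    · have h : (B : ℂ) * B.den = B.num := by
        exact_mod_cast congrArg (Rat.cast (K := ℂ)) B.mul_den_eq_num
      rw [if_neg hn, if_neg hn, ← hB, ← h, smul_eq_mul]
      simp only [zero_add, eq_intCast, Int.cast_mul, Int.cast_neg, Int.cast_natCast, Int.cast_ofNat]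
      field_simp
  obtain ⟨φ, hφ, hev⟩ := hE.exists_eval_eq
    (RamanujanTriple.seventeen_twenty_eight_ne_zero hp) (p - 1)
  refine ⟨MvPolynomial.C ((B.num : ℤ) : ZMod p)⁻¹ * φ, ?_, ?_⟩
  · simpa using (MvPolynomial.isWeightedHomogeneous_C eisensteinWeight _).mul hφ
  · have hd : ((B.den : ℕ) : ZMod p) = 0 := (ZMod.natCast_eq_zero_iff _ _).mpr hden
    have hC : (triple.map (Int.castRingHom (ZMod p))).eval
        (MvPolynomial.C ((B.num : ℤ) : ZMod p)⁻¹) = PowerSeries.C ((B.num : ℤ) : ZMod p)⁻¹ := by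
      simp [RamanujanTriple.eval]
    rw [map_mul, hC, hev, map_add, map_mul, PowerSeries.map_C, PowerSeries.map_C]
    simp only [eq_intCast, Int.cast_neg, Int.cast_mul, Int.cast_natCast, hd, mul_zero, neg_zero,
      map_zero, zero_mul, add_zero]
    rw [← map_mul, inv_mul_cancel₀ hnum, map_one]

end IntegralEisenstein

end

/-! ### Hecke operators as sums over cosets -/

section

open UpperHalfPlane ModularForm Complex
open scoped Manifold

namespace Hecke

/-- The upper triangular integral matrix with rows `(a, b)` and `(0, d)`. -/
def upperMatrix (a d b : ℕ) : Matrix (Fin 2) (Fin 2) ℤ := !![(a : ℤ), b; 0, d]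

lemma det_upperMatrix (a d b : ℕ) : (upperMatrix a d b).det = a * d := by
  simp [upperMatrix, Matrix.det_fin_two]

/-- Every integral matrix of positive determinant is left equivalent under `SL(2, ℤ)` to a reduced
upper triangular one. -/
lemma exists_eq_mul_upperMatrix {n : ℕ} (hn : n ≠ 0) (A : Matrix (Fin 2) (Fin 2) ℤ)
    (hA : A.det = n) : ∃ a d b : ℕ, a * d = n ∧ b < d ∧
      ∃ γ : SL(2, ℤ), A = (γ : Matrix (Fin 2) (Fin 2) ℤ) * upperMatrix a d b := by
  refine FixedDetMatrices.induction_on (m := (n : ℤ)) (A := ⟨A, hA⟩)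
    (C := fun B ↦ ∃ a d b : ℕ, a * d = n ∧ b < d ∧
      ∃ γ : SL(2, ℤ), B.1 = (γ : Matrix (Fin 2) (Fin 2) ℤ) * upperMatrix a d b)
    (by exact_mod_cast hn) ?_ ?_ ?_
  · intro B h10 h00 h01 h11
    have hdet := B.2
    rw [Matrix.det_fin_two, h10, mul_zero, sub_zero] at hdet
    have hd : 0 < B.1 1 1 := by
      refine pos_of_mul_pos_right ?_ h00.le
      rw [hdet]
      exact_mod_cast Nat.pos_of_ne_zero hn
    rw [abs_of_nonneg h01, abs_of_pos hd] at h11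
    obtain ⟨a, ha⟩ := Int.eq_ofNat_of_zero_le h00.le
    obtain ⟨d, hd⟩ := Int.eq_ofNat_of_zero_le hd.le
    obtain ⟨b, hb⟩ := Int.eq_ofNat_of_zero_le h01
    refine ⟨a, d, b, ?_, ?_, 1, ?_⟩
    · rw [ha, hd] at hdet
      exact_mod_cast hdet
    · rw [hb, hd] at h11
      exact_mod_cast h11
    · ext i j
      fin_cases i <;> fin_cases j <;> simp [upperMatrix, ha, hb, hd, h10]
  · rintro B ⟨a, d, b, h1, h2, γ, h3⟩
    exact ⟨a, d, b, h1, h2, ModularGroup.S * γ, by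
      rw [FixedDetMatrices.smul_coe, h3, ← mul_assoc]; rfl⟩
  · rintro B ⟨a, d, b, h1, h2, γ, h3⟩
    exact ⟨a, d, b, h1, h2, ModularGroup.T * γ, by
      rw [FixedDetMatrices.smul_coe, h3, ← mul_assoc]; rfl⟩

/-- Reduced upper triangular matrices of positive determinant are inequivalent under left
multiplication by `SL(2, ℤ)`. -/
lemma eq_of_upperMatrix_eq_mul {a d b a' d' b' : ℕ} (ha : 0 < a) (ha' : 0 < a') (hb : b < d)
    (hb' : b' < d') {γ : SL(2, ℤ)}
    (h : upperMatrix a d b = (γ : Matrix (Fin 2) (Fin 2) ℤ) * upperMatrix a' d' b') :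
    a = a' ∧ d = d' ∧ b = b' := by
  have h00 := congrFun₂ h 0 0
  have h01 := congrFun₂ h 0 1
  have h10 := congrFun₂ h 1 0
  have h11 := congrFun₂ h 1 1
  simp [upperMatrix, Matrix.mul_apply, Fin.sum_univ_two] at h00 h01 h10 h11
  have hdet := γ.2
  rw [Matrix.det_fin_two] at hdet
  have hz : (γ : Matrix (Fin 2) (Fin 2) ℤ) 1 0 = 0 := h10.resolve_right ha'.ne'
  simp only [hz, mul_zero, sub_zero, zero_mul, zero_add] at hdet h11
  have hx : 0 < (γ : Matrix (Fin 2) (Fin 2) ℤ) 0 0 := by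
    refine pos_of_mul_pos_left (b := (a' : ℤ)) ?_ (by omega)
    rw [← h00]; omega
  have hx1 : (γ : Matrix (Fin 2) (Fin 2) ℤ) 0 0 = 1 := by
    rcases Int.mul_eq_one_iff_eq_one_or_neg_one.mp hdet with h | h <;> omega
  rw [hx1, one_mul] at hdet h00 h01
  rw [hdet, one_mul] at h11
  have hd : d = d' := by exact_mod_cast h11
  subst hd
  refine ⟨by exact_mod_cast h00, rfl, ?_⟩
  have hmod : (b : ℤ) % d = b' % d := by
    rw [h01, Int.add_mul_emod_self_right]
  rw [Int.emod_eq_of_lt (by omega) (by omega), Int.emod_eq_of_lt (by omega) (by omega)] at hmod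
  exact_mod_cast hmod

/-- The real matrix underlying `upperMatrix a d b`. -/
noncomputable def upperGL (a d b : ℕ) (h : a * d ≠ 0) : GL (Fin 2) ℝ :=
  Matrix.GeneralLinearGroup.mkOfDetNeZero ((upperMatrix a d b).map (Int.castRingHom ℝ)) (by
    rw [← RingHom.mapMatrix_apply, ← RingHom.map_det, det_upperMatrix]
    simpa using h)

lemma coe_upperGL (a d b : ℕ) (h : a * d ≠ 0) :
    (upperGL a d b h : Matrix (Fin 2) (Fin 2) ℝ) =
      (upperMatrix a d b).map (Int.castRingHom ℝ) := rfl

/-- Indices `((a, d), b)` of the terms of the Hecke operator `T_n`. -/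
def index (n : ℕ) : Finset ((_ : ℕ × ℕ) × ℕ) :=
  n.divisorsAntidiagonal.sigma fun x ↦ Finset.range x.2

lemma mem_index {n : ℕ} {i : (_ : ℕ × ℕ) × ℕ} :
    i ∈ index n ↔ (i.1.1 * i.1.2 = n ∧ n ≠ 0) ∧ i.2 < i.1.2 := by
  simp [index]

lemma mul_ne_zero_of_index {n : ℕ} (i : index n) : i.1.1.1 * i.1.1.2 ≠ 0 := by
  have := mem_index.mp i.2
  rw [this.1.1]
  exact this.1.2

lemma slash_upperGL_apply (k : ℤ) (f : ℍ → ℂ) {a d : ℕ} (b : ℕ) (h : a * d ≠ 0) (z : ℍ) :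
    (f ∣[k] upperGL a d b h) z = ((a * d : ℕ) : ℂ) ^ (k - 1) * ((d : ℂ) ^ (-k) *
      f (ofComplex (((a : ℂ) * (z : ℂ) + b) / d))) := by
  have hdet : (upperGL a d b h).det.val = (a * d : ℕ) := by
    rw [Matrix.GeneralLinearGroup.val_det_apply, coe_upperGL, ← RingHom.mapMatrix_apply,
      ← RingHom.map_det, det_upperMatrix]
    simp
  have hpos : 0 < (upperGL a d b h).det.val := by
    rw [hdet]
    exact_mod_cast Nat.pos_of_ne_zero h
  have hden : denom (upperGL a d b h) z = d := by
    simp [denom, coe_upperGL, upperMatrix]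
  have hnum : num (upperGL a d b h) z = a * z + b := by
    simp [num, coe_upperGL, upperMatrix]
  have hz : upperGL a d b h • z = ofComplex (((a : ℂ) * (z : ℂ) + b) / d) := by
    rw [← ofComplex_apply (upperGL a d b h • z), coe_smul_of_det_pos hpos, hden, hnum]
  rw [slash_apply, hz, hden, hdet, σ, if_pos hpos]
  simp
  ring

lemma heckeOperator_eq_sum_slash (k : ℤ) (n : ℕ) (f : ℍ → ℂ) :
    heckeOperator k n f =
      ∑ i : index n, f ∣[k] upperGL i.1.1.1 i.1.1.2 i.1.2 (mul_ne_zero_of_index i) := by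
  ext z
  rw [Finset.sum_apply]
  simp only [slash_upperGL_apply]
  have h (i : index n) : i.1.1.1 * i.1.1.2 = n := (mem_index.mp i.2).1.1
  simp only [h, ← Finset.mul_sum]
  rw [heckeOperator, Finset.sum_coe_sort (index n) (fun i ↦ (i.1.2 : ℂ) ^ (-k) *
      f (ofComplex (((i.1.1 : ℂ) * (z : ℂ) + i.2) / i.1.2))), index, Finset.sum_sigma]

lemma mdifferentiable_heckeOperator (k : ℤ) (n : ℕ) {f : ℍ → ℂ} (hf : MDiff f) :
    MDiff (heckeOperator k n f) := by
  rw [heckeOperator_eq_sum_slash]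
  exact Finset.sum_induction _ (fun g : ℍ → ℂ ↦ MDiff g) (fun _ _ ↦ MDifferentiable.add)
    mdifferentiable_const fun i _ ↦ hf.slash _ _

/-- Right multiplication by an element of `SL(2, ℤ)` permutes the left `SL(2, ℤ)`-cosets of integral
matrices of determinant `n`. -/
lemma heckeOperator_slash (k : ℤ) (n : ℕ) {f : ℍ → ℂ} (hf : ∀ γ : SL(2, ℤ), f ∣[k] γ = f)
    (γ : SL(2, ℤ)) : heckeOperator k n f ∣[k] γ = heckeOperator k n f := by
  have H : ∀ i : index n, ∃ j : index n, ∃ δ : SL(2, ℤ),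
      upperMatrix i.1.1.1 i.1.1.2 i.1.2 * γ =
        (δ : Matrix (Fin 2) (Fin 2) ℤ) * upperMatrix j.1.1.1 j.1.1.2 j.1.2 := by
    intro i
    have hi := mem_index.mp i.2
    obtain ⟨a, d, b, h1, h2, δ, h3⟩ := exists_eq_mul_upperMatrix hi.1.2
      (upperMatrix i.1.1.1 i.1.1.2 i.1.2 * γ) (by
        rw [Matrix.det_mul, det_upperMatrix, γ.det_coe, mul_one]
        exact_mod_cast hi.1.1)
    exact ⟨⟨⟨(a, d), b⟩, mem_index.mpr ⟨⟨h1, hi.1.2⟩, h2⟩⟩, δ, h3⟩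
  choose π δ hπ using H
  have hinj : Function.Injective π := by
    intro i j hij
    have h : upperMatrix i.1.1.1 i.1.1.2 i.1.2 =
        ((δ i * (δ j)⁻¹ : SL(2, ℤ)) : Matrix (Fin 2) (Fin 2) ℤ) *
          upperMatrix j.1.1.1 j.1.1.2 j.1.2 := by
      have hj : ((δ j)⁻¹ : SL(2, ℤ)).1 * (upperMatrix j.1.1.1 j.1.1.2 j.1.2 * γ) =
          upperMatrix (π j).1.1.1 (π j).1.1.2 (π j).1.2 := by
        rw [hπ, ← mul_assoc, ← Matrix.SpecialLinearGroup.coe_mul, inv_mul_cancel]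
        simp
      have h1 := hπ i
      rw [hij, ← hj, ← mul_assoc, ← mul_assoc] at h1
      have h2 := congrArg (· * (γ⁻¹ : SL(2, ℤ)).1) h1
      simp only [mul_assoc, ← Matrix.SpecialLinearGroup.coe_mul, mul_inv_cancel] at h2
      simpa [mul_assoc] using h2
    have hi := mem_index.mp i.2
    have hj := mem_index.mp j.2
    have hi0 := mul_ne_zero_of_index i
    have hj0 := mul_ne_zero_of_index j
    obtain ⟨h1, h2, h3⟩ := eq_of_upperMatrix_eq_mul
      (Nat.pos_of_ne_zero (left_ne_zero_of_mul hi0))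
      (Nat.pos_of_ne_zero (left_ne_zero_of_mul hj0)) hi.2 hj.2 h
    exact Subtype.ext (Sigma.ext (Prod.ext h1 h2) (heq_of_eq h3))
  rw [heckeOperator_eq_sum_slash, SL_slash, SlashAction.sum_slash]
  refine Fintype.sum_equiv (Equiv.ofBijective π (Finite.injective_iff_bijective.mp hinj)) _ _ ?_
  intro i
  have hGL : upperGL i.1.1.1 i.1.1.2 i.1.2 (mul_ne_zero_of_index i) * (γ : GL (Fin 2) ℝ) =
      (δ i : GL (Fin 2) ℝ) *
        upperGL (π i).1.1.1 (π i).1.1.2 (π i).1.2 (mul_ne_zero_of_index (π i)) := by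
    apply Units.ext
    have h := congrArg (fun A ↦ (Int.castRingHom ℝ).mapMatrix A) (hπ i)
    simp only [map_mul] at h
    exact h
  rw [← SlashAction.slash_mul, hGL, SlashAction.slash_mul, ← SL_slash, hf]
  rfl

end Hecke

end

/-! ### Hecke operators on `q`-expansions and their commutation -/

section

open UpperHalfPlane ModularForm Complex Function
open scoped Manifold Real

namespace Hecke

lemma sum_pow_mul_of_isPrimitiveRoot {ζ : ℂ} {d : ℕ} (hζ : IsPrimitiveRoot ζ d) (m : ℕ) :
    ∑ b ∈ Finset.range d, (ζ ^ m) ^ b = if d ∣ m then (d : ℂ) else 0 := by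
  split_ifs with h
  · simp [(hζ.pow_eq_one_iff_dvd m).mpr h]
  · have h1 : ζ ^ m ≠ 1 := mt (hζ.pow_eq_one_iff_dvd m).mp h
    rw [geom_sum_eq h1, ← pow_mul, mul_comm m, pow_mul, hζ.pow_eq_one, one_pow, sub_self, zero_div]

/-- Averaging over the translates by `b / d` selects the exponents divisible by `d`. -/
lemma hasSum_sum_translates {f : ℍ → ℂ} {c : ℕ → ℂ}
    (h : ∀ τ : ℍ, HasSum (fun m ↦ c m • Periodic.qParam 1 τ ^ m) (f τ))
    {a d : ℕ} (ha : 0 < a) (hd : 0 < d) (τ : ℍ) :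
    HasSum (fun r ↦ (if a ∣ r then (d : ℂ) * c (d * (r / a)) else 0) • Periodic.qParam 1 τ ^ r)
      (∑ b ∈ Finset.range d, f (ofComplex (((a : ℂ) * (τ : ℂ) + b) / d))) := by
  have hd0 : (d : ℂ) ≠ 0 := by exact_mod_cast hd.ne'
  set ζ : ℂ := cexp (2 * π * Complex.I / d)
  have hζ : IsPrimitiveRoot ζ d := Complex.isPrimitiveRoot_exp d hd.ne'
  set u : ℂ := cexp (2 * π * Complex.I * (a * τ) / d)
  have hu : u ^ d = Periodic.qParam 1 τ ^ a := by
    simp only [u, Periodic.qParam, ← Complex.exp_nat_mul]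
    congr 1
    push_cast
    field_simp
  have him (b : ℕ) : 0 < (((a : ℂ) * (τ : ℂ) + b) / d).im := by
    rw [← Complex.ofReal_natCast d, Complex.div_ofReal_im]
    have := τ.im_pos
    simp only [add_im, mul_im, natCast_re, natCast_im, zero_mul, add_zero, coe_im]
    positivity
  have hq (b : ℕ) : Periodic.qParam 1 (((a : ℂ) * (τ : ℂ) + b) / d) = u * ζ ^ b := by
    simp only [u, ζ, Periodic.qParam, ← Complex.exp_nat_mul, ← Complex.exp_add]
    congr 1
    push_cast
    field_simp
  have h1 : HasSum (fun m ↦ ∑ b ∈ Finset.range d, c m • (u * ζ ^ b) ^ m)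
      (∑ b ∈ Finset.range d, f (ofComplex (((a : ℂ) * (τ : ℂ) + b) / d))) := by
    refine hasSum_sum fun b _ ↦ ?_
    have := h ⟨_, him b⟩
    simp only [hq] at this
    rwa [ofComplex_apply_of_im_pos (him b)]
  have h2 (m : ℕ) : ∑ b ∈ Finset.range d, c m • (u * ζ ^ b) ^ m =
      if d ∣ m then (d : ℂ) * c m * u ^ m else 0 := by
    have : ∀ b, c m • (u * ζ ^ b) ^ m = c m * u ^ m * (ζ ^ m) ^ b := by
      intro b
      rw [smul_eq_mul, mul_pow, ← pow_mul, ← pow_mul, mul_comm b m]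
      ring
    simp only [this, ← Finset.mul_sum, sum_pow_mul_of_isPrimitiveRoot hζ]
    split_ifs <;> ring
  simp only [h2] at h1
  have hinj (e : ℕ) (he : 0 < e) : Injective fun m : ℕ ↦ e * m :=
    fun _ _ hxy ↦ Nat.eq_of_mul_eq_mul_left he hxy
  rw [← (hinj d hd).hasSum_iff (fun m hm ↦ if_neg fun ⟨x, hx⟩ ↦ hm ⟨x, hx.symm⟩)] at h1
  rw [← (hinj a ha).hasSum_iff (fun m hm ↦ by
    rw [if_neg fun ⟨x, hx⟩ ↦ hm ⟨x, hx.symm⟩, zero_smul])]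
  refine h1.congr_fun fun m ↦ ?_
  simp only [comp_apply, dvd_mul_right, if_true, Nat.mul_div_cancel_left _ ha, pow_mul, hu,
    smul_eq_mul]

/-- The effect of the Hecke operator `T_n` of weight `k` on coefficients of `q`-expansions:
`c ↦ (r ↦ ∑ a ^ (k - 1) c(n r / a ^ 2))`, summed over the common divisors `a` of `n` and `r`. -/
noncomputable def coeffOp (k : ℤ) (n : ℕ) (c : ℕ → ℂ) (r : ℕ) : ℂ :=
  ∑ x ∈ n.divisorsAntidiagonal, if x.1 ∣ r then (x.1 : ℂ) ^ (k - 1) * c (x.2 * (r / x.1)) else 0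

lemma hasSum_heckeOperator (k : ℤ) (n : ℕ) {f : ℍ → ℂ} {c : ℕ → ℂ}
    (h : ∀ τ : ℍ, HasSum (fun m ↦ c m • Periodic.qParam 1 τ ^ m) (f τ)) (τ : ℍ) :
    HasSum (fun r ↦ coeffOp k n c r • Periodic.qParam 1 τ ^ r) (heckeOperator k n f τ) := by
  simp only [heckeOperator, coeffOp, Finset.mul_sum, Finset.sum_smul]
  refine hasSum_sum fun x hx ↦ ?_
  obtain ⟨hx, hn⟩ := Nat.mem_divisorsAntidiagonal.mp hx
  rw [← hx] at hn
  have ha : 0 < x.1 := Nat.pos_of_ne_zero (left_ne_zero_of_mul hn)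
  have hd : 0 < x.2 := Nat.pos_of_ne_zero (right_ne_zero_of_mul hn)
  have ha0 : (x.1 : ℂ) ≠ 0 := by exact_mod_cast ha.ne'
  have hd0 : (x.2 : ℂ) ≠ 0 := by exact_mod_cast hd.ne'
  have h1 := (hasSum_sum_translates h ha hd τ).mul_left ((n : ℂ) ^ (k - 1) * (x.2 : ℂ) ^ (-k))
  rw [Finset.mul_sum] at h1
  simp only [mul_assoc] at h1
  refine h1.congr_fun fun r ↦ ?_
  split_ifs
  · have : (n : ℂ) ^ (k - 1) * (x.2 : ℂ) ^ (-k) * x.2 = (x.1 : ℂ) ^ (k - 1) := by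
      rw [← hx, Nat.cast_mul, mul_zpow, mul_assoc, mul_assoc, ← zpow_add_one₀ hd0,
        ← zpow_add₀ hd0, show k - 1 + (-k + 1) = 0 by ring, zpow_zero, mul_one]
    rw [← this]
    simp only [smul_eq_mul]
    ring
  · simp

/-- The Hecke operator on modular forms of level one. -/
noncomputable def onModularForm (k : ℤ) (n : ℕ) (f : ModularForm 𝒮ℒ k) : ModularForm 𝒮ℒ k :=
  (HasQExpansion.of_hasSum (mdifferentiable_heckeOperator k n f.holo')
    (hasSum_heckeOperator k n (HasQExpansion.of_modularForm f).hasSum)).toModularForm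
    (heckeOperator_slash k n f.slash_SL_eq)

lemma qExpansion_onModularForm_coeff (k : ℤ) (n : ℕ) (f : ModularForm 𝒮ℒ k) (r : ℕ) :
    (qExpansion 1 (onModularForm k n f)).coeff r =
      coeffOp k n (fun m ↦ (qExpansion 1 f).coeff m) r :=
  (HasQExpansion.of_modularForm _).coeff_unique
    (hasSum_heckeOperator k n (HasQExpansion.of_modularForm f).hasSum) r

lemma heckeOperator_add (k : ℤ) (n : ℕ) (f g : ℍ → ℂ) :
    heckeOperator k n (f + g) = heckeOperator k n f + heckeOperator k n g := by
  ext z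
  simp [heckeOperator, mul_add, Finset.sum_add_distrib]

lemma heckeOperator_smul (k : ℤ) (n : ℕ) (c : ℂ) (f : ℍ → ℂ) :
    heckeOperator k n (c • f) = c • heckeOperator k n f := by
  ext z
  simp only [heckeOperator, Pi.smul_apply, smul_eq_mul, Finset.mul_sum]
  refine Finset.sum_congr rfl fun x _ ↦ Finset.sum_congr rfl fun b _ ↦ ?_
  ring

/-- The Hecke operator `T_n` as an endomorphism of the space of cusp forms. -/
noncomputable def onCuspForm (k : ℤ) (n : ℕ) : CuspForm 𝒮ℒ k →ₗ[ℂ] CuspForm 𝒮ℒ k where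
  toFun f := toCuspForm (onModularForm k n (CuspForm.toModularFormₗ f)) (by
    rw [qExpansion_onModularForm_coeff, coeffOp]
    refine Finset.sum_eq_zero fun x _ ↦ ?_
    have h0 : (qExpansion 1 f).coeff 0 = 0 := CuspFormClass.qExpansion_coeff_zero f one_pos
      one_mem_strictPeriods_SL
    rw [Nat.zero_div, mul_zero, show ⇑(CuspForm.toModularFormₗ f) = ⇑f from rfl, h0, mul_zero,
      ite_self])
  map_add' f g := DFunLike.ext _ _ fun z ↦ congrFun (heckeOperator_add k n f g) z
  map_smul' c f := DFunLike.ext _ _ fun z ↦ congrFun (heckeOperator_smul k n c f) z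

lemma qExpansion_onCuspForm_coeff (k : ℤ) (n : ℕ) (f : CuspForm 𝒮ℒ k) (r : ℕ) :
    (qExpansion 1 (onCuspForm k n f)).coeff r =
      coeffOp k n (fun m ↦ (qExpansion 1 f).coeff m) r :=
  qExpansion_onModularForm_coeff k n (CuspForm.toModularFormₗ f) r

lemma cuspForm_ext_of_coeff {k : ℤ} {f g : CuspForm 𝒮ℒ k}
    (h : ∀ m, (qExpansion 1 f).coeff m = (qExpansion 1 g).coeff m) : f = g := by
  refine DFunLike.ext _ _ fun z ↦ ?_
  have hf := (HasQExpansion.of_modularForm (CuspForm.toModularFormₗ f)).hasSum z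
  have hg := (HasQExpansion.of_modularForm (CuspForm.toModularFormₗ g)).hasSum z
  refine hf.unique (hg.congr_fun fun m ↦ ?_)
  change (qExpansion 1 f).coeff m • _ = (qExpansion 1 g).coeff m • _
  rw [h]

/-- The summand attached to factorizations `m = a d` and `n = a' d'` in the composite of two Hecke
operators. -/
noncomputable def pairTerm (k : ℤ) (c : ℕ → ℂ) (r a d a' d' : ℕ) : ℂ :=
  if a ∣ r ∧ a' ∣ d * (r / a) then
    (a : ℂ) ^ (k - 1) * ((a' : ℂ) ^ (k - 1) * c (d' * (d * (r / a) / a'))) else 0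

lemma coeffOp_coeffOp (k : ℤ) (m n : ℕ) (c : ℕ → ℂ) (r : ℕ) :
    coeffOp k m (coeffOp k n c) r = ∑ x ∈ m.divisorsAntidiagonal, ∑ y ∈ n.divisorsAntidiagonal,
      pairTerm k c r x.1 x.2 y.1 y.2 := by
  refine Finset.sum_congr rfl fun x _ ↦ ?_
  rw [coeffOp, Finset.mul_sum]
  split_ifs with h
  · refine Finset.sum_congr rfl fun y _ ↦ ?_
    simp only [pairTerm, h, true_and, mul_ite, mul_zero]
  · simp [pairTerm, h]

lemma pairTerm_eq (k : ℤ) (c : ℕ → ℂ) (r : ℕ) {g h u x y : ℕ} (v : ℕ) (hg : 0 < g) (hh : 0 < h)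
    (hu : 0 < u) (hy : 0 < y) (hxy : Nat.Coprime x y) :
    pairTerm k c r (h * u) (g * x) (g * y) (h * v) = if h * u * y ∣ r then
      ((h * u * g * y : ℕ) : ℂ) ^ (k - 1) * c (h * v * x * (r / (h * u * y))) else 0 := by
  have hiff : h * u ∣ r ∧ g * y ∣ g * x * (r / (h * u)) ↔ h * u * y ∣ r := by
    rw [mul_assoc g, Nat.mul_dvd_mul_iff_left hg, hxy.symm.dvd_mul_left]
    constructor
    · rintro ⟨⟨s, rfl⟩, h2⟩
      rw [Nat.mul_div_cancel_left _ (by positivity)] at h2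
      exact mul_dvd_mul_left _ h2
    · rintro ⟨s, rfl⟩
      refine ⟨⟨y * s, by ring⟩, ?_⟩
      rw [mul_assoc (h * u), Nat.mul_div_cancel_left _ (by positivity)]
      exact dvd_mul_right _ _
  simp only [pairTerm, hiff]
  split_ifs with hr
  · obtain ⟨s, rfl⟩ := hr
    have h1 : h * u * y * s / (h * u) = y * s := by
      rw [mul_assoc (h * u), Nat.mul_div_cancel_left _ (by positivity)]
    have h2 : g * x * (y * s) / (g * y) = x * s := by
      rw [show g * x * (y * s) = g * y * (x * s) by ring,
        Nat.mul_div_cancel_left _ (by positivity)]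
    rw [h1, h2, Nat.mul_div_cancel_left _ (by positivity), ← mul_assoc, ← mul_assoc, ← mul_zpow]
    push_cast
    ring_nf
  · rfl

/-- The involution exchanging `gcd(d, a')` and `gcd(a, d')` on pairs of factorizations
`m = a d`, `n = a' d'`. -/
def swapGCD (x : (ℕ × ℕ) × (ℕ × ℕ)) : (ℕ × ℕ) × (ℕ × ℕ) :=
  ((x.1.1 / x.1.1.gcd x.2.2 * x.1.2.gcd x.2.1, x.1.2 / x.1.2.gcd x.2.1 * x.1.1.gcd x.2.2),
    (x.2.1 / x.1.2.gcd x.2.1 * x.1.1.gcd x.2.2, x.2.2 / x.1.1.gcd x.2.2 * x.1.2.gcd x.2.1))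

lemma swapGCD_mul {g h u v x y : ℕ} (hg : 0 < g) (hh : 0 < h) (huv : Nat.Coprime u v)
    (hxy : Nat.Coprime x y) :
    swapGCD ((h * u, g * x), (g * y, h * v)) = ((g * u, h * x), (h * y, g * v)) := by
  have h1 : (h * u).gcd (h * v) = h := by rw [Nat.gcd_mul_left, huv, mul_one]
  have h2 : (g * x).gcd (g * y) = g := by rw [Nat.gcd_mul_left, hxy, mul_one]
  simp only [swapGCD, h1, h2, Nat.mul_div_cancel_left _ hg, Nat.mul_div_cancel_left _ hh,
    mul_comm]

/-- The coordinates in which `swapGCD` exchanges `g` and `h`. -/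
lemma exists_eq_mul_of_mem {m n : ℕ} {z : (ℕ × ℕ) × (ℕ × ℕ)}
    (hz : z ∈ m.divisorsAntidiagonal ×ˢ n.divisorsAntidiagonal) :
    ∃ g h u v x y : ℕ, 0 < g ∧ 0 < h ∧ 0 < u ∧ 0 < y ∧ Nat.Coprime u v ∧ Nat.Coprime x y ∧
      z = ((h * u, g * x), (g * y, h * v)) := by
  obtain ⟨⟨a, d⟩, a', d'⟩ := z
  simp only [Finset.mem_product, Nat.mem_divisorsAntidiagonal] at hz
  obtain ⟨⟨h1, hm⟩, h2, hn⟩ := hz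
  have ha : 0 < a := Nat.pos_of_ne_zero (left_ne_zero_of_mul (h1 ▸ hm))
  have ha' : 0 < a' := Nat.pos_of_ne_zero (left_ne_zero_of_mul (h2 ▸ hn))
  obtain ⟨u, v, huv, hu, hv⟩ := Nat.exists_coprime a d'
  obtain ⟨x, y, hxy, hx, hy⟩ := Nat.exists_coprime d a'
  refine ⟨d.gcd a', a.gcd d', u, v, x, y, Nat.gcd_pos_of_pos_right _ ha',
    Nat.gcd_pos_of_pos_left _ ha, Nat.pos_of_mul_pos_right (hu ▸ ha),
    Nat.pos_of_mul_pos_right (hy ▸ ha'), huv, hxy, ?_⟩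
  rw [mul_comm _ u, mul_comm _ v, mul_comm _ x, mul_comm _ y, ← hu, ← hv, ← hx, ← hy]

/-- Hecke operators commute: the involution `swapGCD` matches the terms of the two composites. -/
lemma coeffOp_comm (k : ℤ) (m n : ℕ) (c : ℕ → ℂ) :
    coeffOp k m (coeffOp k n c) = coeffOp k n (coeffOp k m c) := by
  ext r
  rw [coeffOp_coeffOp, coeffOp_coeffOp, Finset.sum_comm (s := n.divisorsAntidiagonal),
    ← Finset.sum_product', ← Finset.sum_product']
  have hmem : ∀ z ∈ m.divisorsAntidiagonal ×ˢ n.divisorsAntidiagonal,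
      swapGCD z ∈ m.divisorsAntidiagonal ×ˢ n.divisorsAntidiagonal := by
    intro z hz
    obtain ⟨g, h, u, v, x, y, hg, hh, hu, hy, huv, hxy, rfl⟩ := exists_eq_mul_of_mem hz
    rw [swapGCD_mul hg hh huv hxy]
    simp only [Finset.mem_product, Nat.mem_divisorsAntidiagonal] at hz ⊢
    rw [← hz.1.1, ← hz.2.1] at *
    exact ⟨⟨by ring, hz.1.2⟩, by ring, hz.2.2⟩
  have hinv : ∀ z ∈ m.divisorsAntidiagonal ×ˢ n.divisorsAntidiagonal,
      swapGCD (swapGCD z) = z := by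
    intro z hz
    obtain ⟨g, h, u, v, x, y, hg, hh, hu, hy, huv, hxy, rfl⟩ := exists_eq_mul_of_mem hz
    rw [swapGCD_mul hg hh huv hxy, swapGCD_mul hh hg huv hxy]
  refine Finset.sum_bij' (fun z _ ↦ swapGCD z) (fun z _ ↦ swapGCD z) hmem hmem hinv hinv ?_
  intro z hz
  obtain ⟨g, h, u, v, x, y, hg, hh, hu, hy, huv, hxy, rfl⟩ := exists_eq_mul_of_mem hz
  rw [swapGCD_mul hg hh huv hxy]
  rw [pairTerm_eq k c r v hg hh hu hy hxy, pairTerm_eq k c r x hg hh hy hu huv.symm]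
  rw [show h * y * u = h * u * y by ring, show h * y * g * u = h * u * g * y by ring,
    show h * x * v = h * v * x by ring]

lemma commute_onCuspForm (k : ℤ) (m n : ℕ) : Commute (onCuspForm k m) (onCuspForm k n) := by
  refine LinearMap.ext fun f ↦ cuspForm_ext_of_coeff fun r ↦ ?_
  rw [Module.End.mul_apply, Module.End.mul_apply, qExpansion_onCuspForm_coeff,
    qExpansion_onCuspForm_coeff]
  simp only [qExpansion_onCuspForm_coeff]
  exact congrFun (coeffOp_comm k m n _) r

end Hecke

end

/-! ### Eigenvectors, integral matrices and echelon bases -/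

section

open UpperHalfPlane ModularForm

/-- A commuting family of endomorphisms has a common eigenvector: a minimal nonzero invariant
subspace is contained in an eigenspace of each member. -/
lemma Module.End.exists_common_eigenvector {K V ι : Type*} [Field K] [IsAlgClosed K]
    [AddCommGroup V] [Module K V] [FiniteDimensional K V] [Nontrivial V]
    (T : ι → Module.End K V) (hT : ∀ i j, Commute (T i) (T j)) :
    ∃ v, v ≠ 0 ∧ ∀ i, ∃ c : K, T i v = c • v := by
  obtain ⟨W, ⟨hW0, hW⟩, hmin⟩ := (wellFounded_lt (α := Submodule K V)).has_min
    {W | W ≠ ⊥ ∧ ∀ i, ∀ w ∈ W, T i w ∈ W} ⟨⊤, top_ne_bot, fun _ _ _ ↦ Submodule.mem_top⟩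
  obtain ⟨v, hvW, hv⟩ := Submodule.exists_mem_ne_zero_of_ne_bot hW0
  refine ⟨v, hv, fun i ↦ ?_⟩
  have : Nontrivial W := ⟨⟨⟨v, hvW⟩, 0, fun h ↦ hv (congrArg Subtype.val h)⟩⟩
  obtain ⟨c, hc⟩ := Module.End.exists_eigenvalue ((T i).restrict (hW i))
  obtain ⟨⟨w, hwW⟩, hw⟩ := hc.exists_hasEigenvector
  have hw1 : T i w = c • w := congrArg Subtype.val hw.apply_eq_smul
  have hw0 : w ≠ 0 := fun h ↦ hw.2 (Subtype.ext h)
  refine ⟨c, ?_⟩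
  by_contra hne
  refine hmin (W ⊓ LinearMap.ker (T i - c • 1)) ⟨?_, ?_⟩ ?_
  · exact fun h ↦ hw0 ((Submodule.mem_bot K).mp (h ▸ ⟨hwW, by simp [hw1]⟩))
  · rintro j x ⟨hx, hx'⟩
    refine ⟨hW j x hx, ?_⟩
    rw [SetLike.mem_coe, LinearMap.mem_ker, LinearMap.sub_apply, sub_eq_zero] at hx' ⊢
    have := LinearMap.congr_fun (hT i j).eq x
    rw [Module.End.mul_apply, Module.End.mul_apply] at this
    rw [this, hx']
    simp
  · refine lt_of_le_of_ne inf_le_left fun h ↦ hne ?_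
    have hv' : v ∈ W ⊓ LinearMap.ker (T i - c • 1) := by rw [h]; exact hvW
    have := hv'.2
    rw [SetLike.mem_coe, LinearMap.mem_ker, LinearMap.sub_apply, sub_eq_zero] at this
    simpa using this

/-- The eigenvalues of an integral matrix that is invertible modulo `p` are algebraic integers prime
to `p`: the constant term of the minimal polynomial divides the determinant. -/
lemma isAlgebraicIntegerPrimeTo_of_vecMul_eq_smul {p : ℕ} [Fact p.Prime] {m : Type*} [Fintype m]
    [DecidableEq m] {M : Matrix m m ℤ}
    (hM : ∀ w : m → ZMod p, Matrix.vecMul w (M.map (Int.castRingHom (ZMod p))) = 0 → w = 0)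
    {c : ℂ} {w : m → ℂ} (hw : w ≠ 0)
    (h : Matrix.vecMul w (M.map (Int.castRingHom ℂ)) = c • w) : IsAlgebraicIntegerPrimeTo p c := by
  have hroot : Polynomial.aeval c M.charpoly = 0 := by
    have h1 : ((M.map (Int.castRingHom ℂ)).charpoly).eval c = 0 := by
      rw [Matrix.eval_charpoly]
      refine Matrix.exists_vecMul_eq_zero_iff.mp ⟨w, hw, ?_⟩
      rw [Matrix.vecMul_sub, h]
      simp [Matrix.scalar_apply, ← Matrix.smul_one_eq_diagonal, Matrix.vecMul_smul]
    rwa [Matrix.charpoly_map, Polynomial.eval_map] at h1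
  have hint : IsIntegral ℤ c := ⟨M.charpoly, M.charpoly_monic, hroot⟩
  refine ⟨hint, 0, minpoly.natDegree_pos hint, fun hp ↦ ?_⟩
  have hdvd : minpoly ℤ c ∣ M.charpoly := minpoly.isIntegrallyClosed_dvd hint hroot
  have hcoeff : (minpoly ℤ c).coeff 0 ∣ M.charpoly.coeff 0 := by
    obtain ⟨q, hq⟩ := hdvd
    exact ⟨q.coeff 0, by rw [hq, Polynomial.mul_coeff_zero]⟩
  have hdet : (p : ℤ) ∣ M.det := by
    rw [Matrix.det_eq_sign_charpoly_coeff]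
    exact (hp.trans hcoeff).mul_left _
  have hdet' : (M.map (Int.castRingHom (ZMod p))).det = 0 := by
    rw [← RingHom.mapMatrix_apply, ← RingHom.map_det]
    exact (ZMod.intCast_zmod_eq_zero_iff_dvd _ _).mpr hdet
  obtain ⟨v, hv, hv0⟩ := Matrix.exists_vecMul_eq_zero_iff.mpr hdet'
  exact hv (hM v hv0)

namespace IntegralEisenstein

/-- Modulo `p`, an integral form of weight `p - 1` whose coefficients of index divisible by `p`
vanish is zero. -/
lemma IsQExpansion.map_eq_zero {p : ℕ} [Fact p.Prime] (hp : 3 < p)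
    {f : ModularForm 𝒮ℒ ((p - 1 : ℕ) : ℤ)} {F : PowerSeries ℤ} (hf : IsQExpansion f F)
    (h : ∀ n, (p : ℤ) ∣ F.coeff (p * n)) : F.map (Int.castRingHom (ZMod p)) = 0 := by
  obtain ⟨A, hA, hA1⟩ := exists_eval_eq_one hp
  obtain ⟨φ, hφ, hev⟩ := hf.exists_eval_eq (RamanujanTriple.seventeen_twenty_eight_ne_zero hp) _
  rw [← hev]
  refine RamanujanTriple.eval_eq_zero_of_coeff_mul_eq_zero _ hp hA hA1 hφ fun n ↦ ?_
  rw [hev, PowerSeries.coeff_map]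
  exact (ZMod.intCast_zmod_eq_zero_iff_dvd _ _).mpr (h n)

/-- The echelon basis of the space of cusp forms. -/
lemma exists_cuspForm_isQExpansion (k : ℕ) (hk : Even k) (hk2 : k % 12 ≠ 2) (i : Fin (k / 12)) :
    ∃ (f : CuspForm 𝒮ℒ k) (F : PowerSeries ℤ), IsQExpansion (CuspForm.toModularFormₗ f) F ∧
      ∀ j : Fin (k / 12), F.coeff (j + 1) = if j = i then 1 else 0 := by
  obtain ⟨f, F, hf, hF⟩ := exists_isQExpansion_coeff_eq k hk hk2 (PowerSeries.X ^ ((i : ℕ) + 1))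
  have h0 : (qExpansion 1 f).coeff 0 = 0 := by
    rw [hf.coeff, hF 0 (Nat.zero_le _), PowerSeries.coeff_X_pow]
    simp
  refine ⟨toCuspForm f h0, F, hf, fun j ↦ ?_⟩
  rw [hF _ (by omega), PowerSeries.coeff_X_pow]
  simp [Fin.ext_iff]

end IntegralEisenstein

/-- A cusp form is determined by its coefficients up to the Sturm bound. -/
lemma CuspForm.eq_of_coeff_eq {k : ℕ} {f g : CuspForm 𝒮ℒ k}
    (h : ∀ j : Fin (k / 12), (qExpansion 1 f).coeff (j + 1) = (qExpansion 1 g).coeff (j + 1)) :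
    f = g := by
  have hsub : qExpansion 1 (toModularFormₗ f - toModularFormₗ g : ModularForm 𝒮ℒ k) =
      qExpansion 1 f - qExpansion 1 g := by
    rw [FunLike.coe_sub]
    exact ModularForm.qExpansion_sub one_pos one_mem_strictPeriods_SL (toModularFormₗ f)
      (toModularFormₗ g)
  refine toModularFormₗ_injective (sub_eq_zero.mp (ModularForm.sturm_bound_levelOne_nat ?_))
  rw [hsub]
  refine lt_of_lt_of_le (b := ((k / 12 + 1 : ℕ) : ℕ∞)) (by exact_mod_cast Nat.lt_succ_self _)
    (PowerSeries.nat_le_order _ _ ?_)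
  intro i hi
  rw [map_sub]
  rcases i with _ | i
  · rw [CuspFormClass.qExpansion_coeff_zero f one_pos one_mem_strictPeriods_SL,
      CuspFormClass.qExpansion_coeff_zero g one_pos one_mem_strictPeriods_SL, sub_self]
  · rw [h ⟨i, by omega⟩, sub_self]

namespace Hecke

lemma coeffOp_prime (k : ℤ) {p : ℕ} (hp : p.Prime) (c : ℕ → ℂ) (r : ℕ) :
    coeffOp k p c r = c (p * r) + if p ∣ r then (p : ℂ) ^ (k - 1) * c (r / p) else 0 := by
  rw [coeffOp, Nat.sum_divisorsAntidiagonal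
    (f := fun a d ↦ if a ∣ r then (a : ℂ) ^ (k - 1) * c (d * (r / a)) else 0), hp.divisors,
    Finset.sum_pair hp.one_lt.ne]
  simp [Nat.div_self hp.pos]

instance (k : ℤ) : FiniteDimensional ℂ (CuspForm 𝒮ℒ k) :=
  FiniteDimensional.of_injective (CuspForm.toModularFormₗ (Γ := 𝒮ℒ) (k := k))
    CuspForm.toModularFormₗ_injective

end Hecke

end

/-! ### Ordinary eigenforms of weight `p - 1` -/

section

open UpperHalfPlane ModularForm IntegralEisenstein

namespace Hecke

variable {p : ℕ} [Fact p.Prime]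

/-- `T_p` acts on integral forms of weight `k ≥ 2` by `F ↦ ∑ a_{pn} q ^ n` modulo `p`. -/
lemma exists_coeff_onCuspForm_eq {k : ℕ} (hk : 2 ≤ k) {f : CuspForm 𝒮ℒ k} {F : PowerSeries ℤ}
    (hf : IsQExpansion (CuspForm.toModularFormₗ f) F) :
    ∃ G : PowerSeries ℤ, IsQExpansion (CuspForm.toModularFormₗ (onCuspForm k p f)) G ∧
      ∀ r, (p : ℤ) ∣ G.coeff r - F.coeff (p * r) := by
  have hp : p.Prime := Fact.out
  refine ⟨PowerSeries.mk fun r ↦ F.coeff (p * r) +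
    if p ∣ r then (p : ℤ) ^ (k - 1) * F.coeff (r / p) else 0, ?_, fun r ↦ ?_⟩
  · ext r
    have hF (m : ℕ) : (qExpansion 1 f).coeff m = (F.coeff m : ℂ) := hf.coeff m
    have h := qExpansion_onCuspForm_coeff k p f r
    simp only [coeffOp_prime _ hp, hF] at h
    refine h.trans ?_
    rw [PowerSeries.coeff_map, PowerSeries.coeff_mk,
      show ((k : ℤ) - 1) = ((k - 1 : ℕ) : ℤ) by omega, zpow_natCast]
    split_ifs <;> simp
  · rw [PowerSeries.coeff_mk, add_sub_cancel_left]
    split_ifs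
    · exact (dvd_pow_self _ (by omega)).mul_right _
    · exact dvd_zero _

/-- The `r`-th coefficient of the `q`-expansion, as a linear form on cusp forms. -/
noncomputable def coeffLin (k : ℤ) (r : ℕ) : CuspForm 𝒮ℒ k →ₗ[ℂ] ℂ where
  toFun f := (qExpansion 1 f).coeff r
  map_add' f g := by
    have h : qExpansion 1 (⇑(f + g)) = qExpansion 1 f + qExpansion 1 g :=
      ModularForm.qExpansion_add one_pos one_mem_strictPeriods_SL (CuspForm.toModularFormₗ f)
        (CuspForm.toModularFormₗ g)
    rw [h, map_add]
  map_smul' c f := by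
    have h : qExpansion 1 (⇑(c • f)) = c • qExpansion 1 f :=
      (HasQExpansion.of_modularForm (CuspForm.toModularFormₗ f)).qExpansion_smul c
    rw [h, PowerSeries.coeff_smul, RingHom.id_apply]

lemma coeffLin_eq {k : ℤ} {f : CuspForm 𝒮ℒ k} {F : PowerSeries ℤ}
    (hf : IsQExpansion (CuspForm.toModularFormₗ f) F) (r : ℕ) : coeffLin k r f = F.coeff r :=
  hf.coeff r

lemma coeff_sum_C_mul {ι : Type*} [Fintype ι] (u : ι → ℤ) (F : ι → PowerSeries ℤ) (r : ℕ) :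
    (∑ i, PowerSeries.C (u i) * F i).coeff r = ∑ i, u i * (F i).coeff r := by
  simp only [map_sum, PowerSeries.coeff_C_mul]

lemma isQExpansion_sum_smul {k : ℤ} {ι : Type*} [Fintype ι] {f : ι → CuspForm 𝒮ℒ k}
    {F : ι → PowerSeries ℤ} (hf : ∀ i, IsQExpansion (CuspForm.toModularFormₗ (f i)) (F i))
    (u : ι → ℤ) : IsQExpansion (CuspForm.toModularFormₗ (∑ i, (u i : ℂ) • f i))
      (∑ i, PowerSeries.C (u i) * F i) := by
  ext r
  change coeffLin k r (∑ i, (u i : ℂ) • f i) = _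
  rw [PowerSeries.coeff_map, coeff_sum_C_mul]
  simp only [map_sum, map_smul, coeffLin_eq (hf _), smul_eq_mul, eq_intCast, Int.cast_mul]

lemma even_sub_one_and_mod_ne (hp : 11 < p) :
    Even (p - 1) ∧ (p - 1) % 12 ≠ 2 ∧ 12 ≤ p - 1 := by
  have hpp : p.Prime := Fact.out
  have heven : Even (p - 1) := hpp.even_sub_one (by omega)
  refine ⟨heven, fun h ↦ ?_, ?_⟩
  · have h3 : 3 ∣ p := by omega
    rcases (Nat.dvd_prime hpp).mp h3 with h | h <;> omega
  · obtain ⟨m, hm⟩ := heven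
    omega

/-- In weight `p - 1` all eigenvalues of `T_p` on cusp forms are integers prime to `p`: modulo `p`
the operator `T_p` is injective. -/
lemma isAlgebraicIntegerPrimeTo_of_eigenvalue (hp : 11 < p) {f : CuspForm 𝒮ℒ ((p - 1 : ℕ) : ℤ)}
    (hf : f ≠ 0) {c : ℂ} (hc : onCuspForm _ p f = c • f) : IsAlgebraicIntegerPrimeTo p c := by
  obtain ⟨heven, h12, -⟩ := even_sub_one_and_mod_ne hp
  choose b B hB hBδ using exists_cuspForm_isQExpansion (p - 1) heven h12
  choose G hG hGB using fun i ↦ exists_coeff_onCuspForm_eq (p := p) (by omega) (hB i)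
  have hexp (f : CuspForm 𝒮ℒ ((p - 1 : ℕ) : ℤ)) :
      f = ∑ i : Fin ((p - 1) / 12), coeffLin _ (i + 1) f • b i := by
    refine CuspForm.eq_of_coeff_eq fun j ↦ ?_
    change coeffLin _ _ _ = coeffLin _ _ _
    rw [map_sum]
    simp [coeffLin_eq (hB _), hBδ]
  refine isAlgebraicIntegerPrimeTo_of_vecMul_eq_smul (p := p)
    (M := Matrix.of fun i j : Fin ((p - 1) / 12) ↦ (G i).coeff (j + 1))
    (w := fun j ↦ coeffLin _ (j + 1) f) ?_ ?_ ?_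
  · intro w hw
    choose u hu using fun i ↦ ZMod.intCast_surjective (w i)
    have hTu := isQExpansion_sum_smul hG u
    have hdvd (j : Fin ((p - 1) / 12)) :
        (p : ℤ) ∣ (∑ i, PowerSeries.C (u i) * G i).coeff (j + 1) := by
      rw [← ZMod.intCast_zmod_eq_zero_iff_dvd]
      have := congrFun hw j
      simp only [Matrix.vecMul, dotProduct, Matrix.map_apply, Matrix.of_apply, ← hu] at this
      rw [coeff_sum_C_mul]
      simpa using this
    choose e he using hdvd
    -- The form `∑ u i • T_p (b i)` is `p` times an integral combination of the `b j`.
    have hsum : ∑ i, PowerSeries.C (u i) * G i = ∑ j, PowerSeries.C (p * e j) * B j := by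
      apply map_castRingHom_injective
      rw [← hTu, ← isQExpansion_sum_smul hB fun j ↦ p * e j]
      congr 3
      rw [hexp (∑ i, (u i : ℂ) • _)]
      simp only [coeffLin_eq hTu, he]
    have hB0 := (isQExpansion_sum_smul hB u).map_eq_zero (by omega) fun n ↦ by
      have h1 : (p : ℤ) ∣ (∑ i, PowerSeries.C (u i) * G i).coeff n := by
        rw [hsum, coeff_sum_C_mul]
        exact Finset.dvd_sum fun j _ ↦ (dvd_mul_right _ _).mul_right _
      have h2 : (p : ℤ) ∣ (∑ i, PowerSeries.C (u i) * G i).coeff n -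
          (∑ i, PowerSeries.C (u i) * B i).coeff (p * n) := by
        rw [coeff_sum_C_mul, coeff_sum_C_mul, ← Finset.sum_sub_distrib]
        refine Finset.dvd_sum fun j _ ↦ ?_
        rw [← mul_sub]
        exact (hGB j n).mul_left _
      exact (dvd_sub_right h1).mp h2
    ext j
    have := congrArg (PowerSeries.coeff (j + 1)) hB0
    rw [PowerSeries.coeff_map, coeff_sum_C_mul] at this
    simpa [hBδ, hu] using this
  · intro h
    refine hf (CuspForm.eq_of_coeff_eq fun j ↦ ?_)
    change coeffLin _ _ f = coeffLin _ _ 0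
    rw [map_zero]
    exact congrFun h j
  · ext j
    have h := congrArg (coeffLin _ (j + 1)) hc
    rw [hexp f, map_sum, map_sum, ← hexp f] at h
    simp only [map_smul, coeffLin_eq (hG _), smul_eq_mul] at h
    simpa [Matrix.vecMul, dotProduct] using h

end Hecke

end

open UpperHalfPlane ModularForm IntegralEisenstein in
theorem mainTheorem8 (p : ℕ) (hp : p.Prime) (hp11 : 11 < p) :
    ∃ f : CuspForm 𝒮ℒ ((p : ℤ) - 1), IsOrdinaryEigenform p f := by
  have : Fact p.Prime := ⟨hp⟩
  rw [show (p : ℤ) - 1 = ((p - 1 : ℕ) : ℤ) by omega]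
  obtain ⟨heven, h12, hle⟩ := Hecke.even_sub_one_and_mod_ne hp11
  have : Nontrivial (CuspForm 𝒮ℒ ((p - 1 : ℕ) : ℤ)) := by
    obtain ⟨f, F, hf, hF⟩ := exists_cuspForm_isQExpansion (p - 1) heven h12 ⟨0, by omega⟩
    refine ⟨f, 0, fun h ↦ ?_⟩
    have := hF ⟨0, by omega⟩
    rw [hf.eq_zero_of_eq_zero (by rw [h, map_zero])] at this
    simp at this
  obtain ⟨f, hf, h⟩ := Module.End.exists_common_eigenvector
    (fun n ↦ Hecke.onCuspForm ((p - 1 : ℕ) : ℤ) n) (fun m n ↦ Hecke.commute_onCuspForm _ m n)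
  have heig (n : ℕ) : ∃ c : ℂ, heckeOperator ((p - 1 : ℕ) : ℤ) n f = c • ⇑f ∧
      Hecke.onCuspForm _ n f = c • f := by
    obtain ⟨c, hc⟩ := h n
    exact ⟨c, congrArg DFunLike.coe hc, hc⟩
  obtain ⟨c, hc, hc'⟩ := heig p
  exact ⟨f, ⟨hf, fun n _ ↦ (heig n).imp fun _ ↦ And.left⟩, c, hc,
    Hecke.isAlgebraicIntegerPrimeTo_of_eigenvalue hp11 hf hc'⟩
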